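/- Let $m\ge 1$ be an integer. On the real line put $$Q_m(x)=\Big(\frac{x-\mathrm i}{x+\mathrm i}\Big)^m,\qquad \mathbf Q_m(x)=(\mathrm{Re}\,Q_m(x),\mathrm{Im}\,Q_m(x),0)\in\mathbb S^2\subset\mathbb R^3,$$ and consider on $L^2(\mathbb R)=L^2(\mathbb R;\mathbb C)$, with domain $H^1(\mathbb R)$, the operators $$L_+=|\nabla|-|\partial_x\mathbf Q_m|=|\nabla|-\frac{2m}{1+x^2},\qquad L_-=L_++R,$$ $$(Rf)(x)=\frac1{2\pi}\int_{\mathbb R}\frac{|\mathbf Q_m(x)-\mathbf Q_m(y)|^2}{|x-y|^2}\,f(y)\,dy,$$ where $|\nabla|=\sqrt{-\partial_x^2}$ is the Fourier multiplier with symbol $|k|$ with respect to the characters $e^{\mathrm ikx}$. Both operators are self-adjoint. Let $\sigma_{\mathrm p}$ denote the point spectrum (the set of eigenvalues with eigenfunction in $L^2(\mathbb R)$), and let $\sigma_{\mathrm{ess}}$ denote the essential spectrum (the spectrum without the isolated eigenvalues of finite multiplicity). Then the following holds. (i) $\sigma_{\mathrm p}(L_+)=\{E_0,E_1,\dots,E_{2m-1}\}$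 consists of exactly $2m$ eigenvalues; each $E_k$ is simple (its eigenspace is one-dimensional), and $$E_0<E_1<\dots<E_{2m-2}<E_{2m-1}=0.$$ (ii) $\sigma_{\mathrm p}(L_-)=\{0\}$, and the eigenvalue $0$ has multiplicity exactly $2m$, i.e. $\dim\{f\in H^1(\mathbb R): L_-f=0\}=2m$. (iii) $\sigma_{\mathrm{ess}}(L_+)=\sigma_{\mathrm{ess}}(L_-)=[0,\infty)$, and neither $L_+$ nor $L_-$ has an (embedded) eigenvalue $E>0$. -/

import Mathlib

open MeasureTheory

noncomputable section

namespace HalfWave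

/-! ### Point spectrum, resolvent set and essential spectrum of an unbounded operator -/

section Abstract

variable {H : Type*} [NormedAddCommGroup H] [InnerProductSpace ℂ H]

/-- The eigenspace `ker (T - z)`, a subspace of `H` (contained in the domain of `T`). -/
def eigenspace (T : H →ₗ.[ℂ] H) (z : ℂ) : Submodule ℂ H :=
  (LinearMap.ker (T.toFun - z • T.domain.subtype)).map T.domain.subtype

/-- The point spectrum: the set of all eigenvalues. -/
def pointSpectrum (T : H →ₗ.[ℂ] H) : Set ℂ :=
  {z | ∃ f : T.domain, (f : H) ≠ 0 ∧ T f = z • (f : H)}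

/-- The resolvent set: those `z` for which `T - z` is a bijection from the domain of `T` onto `H`
whose inverse is a bounded operator on `H`. -/
def resolventSet (T : H →ₗ.[ℂ] H) : Set ℂ :=
  {z | ∃ B : H →L[ℂ] H,
    (∀ g : H, ∃ h : B g ∈ T.domain, T ⟨B g, h⟩ - z • B g = g) ∧
    ∀ f : T.domain, B (T f - z • (f : H)) = f}

/-- The spectrum: the complement of the resolvent set. -/
def spectrum (T : H →ₗ.[ℂ] H) : Set ℂ := (resolventSet T)ᶜ

/-- The discrete spectrum: isolated points of the spectrum that are eigenvalues of finite
multiplicity. -/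
def discreteSpectrum (T : H →ₗ.[ℂ] H) : Set ℂ :=
  {z | z ∈ spectrum T ∧ (∃ ε > 0, ∀ w ∈ spectrum T, dist w z < ε → w = z) ∧
    z ∈ pointSpectrum T ∧ FiniteDimensional ℂ (eigenspace T z)}

/-- The essential spectrum of a self-adjoint operator: the spectrum without the discrete
spectrum. -/
def essentialSpectrum (T : H →ₗ.[ℂ] H) : Set ℂ := spectrum T \ discreteSpectrum T

theorem mem_eigenspace_iff (T : H →ₗ.[ℂ] H) (z : ℂ) (f : H) :
    f ∈ eigenspace T z ↔ ∃ h : f ∈ T.domain, T ⟨f, h⟩ = z • f := by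
  simp [eigenspace, sub_eq_zero]

end Abstract

/-- The Hilbert space `L²(ℝ; ℂ)`. -/
abbrev L2 : Type := Lp ℂ 2 (volume : Measure ℝ)

/-! ### The operator `|∇|` with domain `H¹(ℝ)` -/

/-- The symbol of `|∇|`. With the normalisation `𝓕 f (ξ) = ∫ exp (-2πixξ) f(x) dx` it is
`2π|ξ|`. -/
def absSymbol (ξ : ℝ) : ℂ := ((2 * Real.pi * |ξ| : ℝ) : ℂ)

/-- The Sobolev space `H¹(ℝ)`: those `f` in `L²` with `|ξ| 𝓕 f (ξ)` in `L²`. -/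
def sobolevOne : Submodule ℂ L2 where
  carrier := {f | MemLp (fun ξ => absSymbol ξ * (FourierTransform.fourier f : L2) ξ) 2 volume}
  zero_mem' := by
    refine (MemLp.zero (p := 2) (μ := (volume : Measure ℝ)) (ε := ℂ)).ae_eq ?_
    have h : (FourierTransform.fourier (0 : L2) : L2) = 0 :=
      (Lp.fourierTransformₗᵢ ℝ ℂ).map_zero
    rw [h]
    filter_upwards [Lp.coeFn_zero ℂ 2 (volume : Measure ℝ)] with ξ hξ
    simp
  add_mem' := by
    intro f g hf hg
    refine (MemLp.add hf hg).ae_eq ?_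
    have h : (FourierTransform.fourier (f + g) : L2)
        = FourierTransform.fourier f + FourierTransform.fourier g :=
      (Lp.fourierTransformₗᵢ ℝ ℂ).map_add f g
    rw [h]
    filter_upwards [Lp.coeFn_add (FourierTransform.fourier f : L2)
      (FourierTransform.fourier g)] with ξ hξ
    rw [hξ, Pi.add_apply, Pi.add_apply, mul_add]
  smul_mem' := by
    intro c f hf
    refine (MemLp.const_smul hf c).ae_eq ?_
    have h : (FourierTransform.fourier (c • f) : L2) = c • FourierTransform.fourier f :=
      (Lp.fourierTransformₗᵢ ℝ ℂ).map_smul c f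
    rw [h]
    filter_upwards [Lp.coeFn_smul c (FourierTransform.fourier f : L2)] with ξ hξ
    rw [hξ, Pi.smul_apply, Pi.smul_apply, smul_eq_mul, smul_eq_mul, mul_left_comm]

theorem memLp_absSymbol_mul (f : sobolevOne) :
    MemLp (fun ξ => absSymbol ξ * (FourierTransform.fourier (f : L2) : L2) ξ) 2 volume := f.2

/-- The operator `|∇|` on `L²(ℝ)` with domain `H¹(ℝ)`: multiplication by `2π|ξ|` on the Fourier
side. -/
def absNabla : L2 →ₗ.[ℂ] L2 where
  domain := sobolevOne
  toFun :=
    { toFun := fun f => FourierTransformInv.fourierInv ((memLp_absSymbol_mul f).toLp _ : L2)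
      map_add' := by
        intro f g
        have h : (FourierTransform.fourier ((f : L2) + g) : L2)
            = FourierTransform.fourier (f : L2) + FourierTransform.fourier (g : L2) :=
          (Lp.fourierTransformₗᵢ ℝ ℂ).map_add f g
        refine Eq.trans (congrArg _ ?_) ((Lp.fourierTransformₗᵢ ℝ ℂ).symm.map_add _ _)
        rw [← MemLp.toLp_add]
        refine MemLp.toLp_congr _ _ ?_
        rw [Submodule.coe_add, h]
        filter_upwards [Lp.coeFn_add (FourierTransform.fourier (f : L2) : L2)
          (FourierTransform.fourier (g : L2))] with ξ hξ
        rw [hξ, Pi.add_apply, Pi.add_apply, mul_add]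
      map_smul' := by
        intro c f
        have h : (FourierTransform.fourier (c • (f : L2)) : L2)
            = c • FourierTransform.fourier (f : L2) :=
          (Lp.fourierTransformₗᵢ ℝ ℂ).map_smul c f
        refine Eq.trans (congrArg _ ?_) ((Lp.fourierTransformₗᵢ ℝ ℂ).symm.map_smul c _)
        rw [← MemLp.toLp_const_smul]
        refine MemLp.toLp_congr _ _ ?_
        rw [Submodule.coe_smul, h]
        filter_upwards [Lp.coeFn_smul c (FourierTransform.fourier (f : L2) : L2)] with ξ hξ
        rw [hξ, Pi.smul_apply, Pi.smul_apply, smul_eq_mul, smul_eq_mul, mul_left_comm] }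

/-! ### The half-harmonic map `Q_m` -/

/-- The Blaschke product `Q_m(x) = ((x - i) / (x + i)) ^ m` on the real line. -/
def blaschke (m : ℕ) (x : ℝ) : ℂ := (((x : ℂ) - Complex.I) / ((x : ℂ) + Complex.I)) ^ m

/-- The map `𝐐_m = (Re Q_m, Im Q_m, 0)` from `ℝ` to the unit sphere of `ℝ³`. -/
def profile (m : ℕ) (x : ℝ) : EuclideanSpace ℝ (Fin 3) :=
  !₂[(blaschke m x).re, (blaschke m x).im, 0]

/-- The function `2m / (1 + x²)`, equal to `|∂ₓ 𝐐_m|` by `norm_deriv_profile` below. -/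
def potential (m : ℕ) (x : ℝ) : ℝ := 2 * m / (1 + x ^ 2)

/-- The integral kernel of `R`. -/
def kernelR (m : ℕ) (x y : ℝ) : ℝ :=
  1 / (2 * Real.pi) * (‖profile m x - profile m y‖ ^ 2 / |x - y| ^ 2)

theorem add_I_ne_zero (x : ℝ) : (x : ℂ) + Complex.I ≠ 0 := by
  intro h
  simpa using congrArg Complex.im h

theorem norm_add_I_sq (x : ℝ) : ‖(x : ℂ) + Complex.I‖ ^ 2 = 1 + x ^ 2 := by
  rw [← Complex.normSq_eq_norm_sq, Complex.normSq_apply]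
  simp
  ring

theorem norm_blaschke_base (x : ℝ) : ‖((x : ℂ) - Complex.I) / ((x : ℂ) + Complex.I)‖ = 1 := by
  have h : ‖(x : ℂ) - Complex.I‖ = ‖(x : ℂ) + Complex.I‖ := by
    rw [← Complex.norm_conj ((x : ℂ) + Complex.I)]
    simp [sub_eq_add_neg]
  rw [norm_div, h, div_self (norm_ne_zero_iff.2 (add_I_ne_zero x))]

theorem norm_vec (a b : ℝ) : ‖(!₂[a, b, 0] : EuclideanSpace ℝ (Fin 3))‖ = ‖(⟨a, b⟩ : ℂ)‖ := by
  rw [EuclideanSpace.norm_eq, Complex.norm_eq_sqrt_sq_add_sq]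
  simp [Fin.sum_univ_three]

theorem norm_profile_sub (m : ℕ) (x y : ℝ) :
    ‖profile m x - profile m y‖ = ‖blaschke m x - blaschke m y‖ := by
  have h : profile m x - profile m y =
      !₂[(blaschke m x - blaschke m y).re, (blaschke m x - blaschke m y).im, 0] := by
    ext i
    fin_cases i <;> simp [profile]
  rw [h, norm_vec]

theorem hasDerivAt_blaschke (m : ℕ) (x : ℝ) :
    HasDerivAt (blaschke m)
      (m * (((x : ℂ) - Complex.I) / ((x : ℂ) + Complex.I)) ^ (m - 1) *
        (2 * Complex.I / ((x : ℂ) + Complex.I) ^ 2)) x := by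
  have h1 : HasDerivAt (fun t : ℝ => (t : ℂ)) 1 x := Complex.ofRealCLM.hasDerivAt
  have h2 := ((h1.sub_const Complex.I).div (h1.add_const Complex.I) (add_I_ne_zero x)).pow m
  refine h2.congr_deriv ?_
  rw [Pi.div_apply]
  congr 2
  ring

theorem norm_deriv_profile (m : ℕ) (x : ℝ) :
    HasDerivAt (profile m) (deriv (profile m) x) x ∧ ‖deriv (profile m) x‖ = potential m x := by
  have h := hasDerivAt_blaschke m x
  set d := (m * (((x : ℂ) - Complex.I) / ((x : ℂ) + Complex.I)) ^ (m - 1) *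
        (2 * Complex.I / ((x : ℂ) + Complex.I) ^ 2)) with hd
  have h3 : HasDerivAt (profile m) (!₂[d.re, d.im, 0] : EuclideanSpace ℝ (Fin 3)) x := by
    have h4 : HasDerivAt (fun t => ![(blaschke m t).re, (blaschke m t).im, 0])
        ![d.re, d.im, 0] x := by
      rw [hasDerivAt_pi]
      intro i
      fin_cases i
      · exact (Complex.reCLM.hasFDerivAt.comp_hasDerivAt x h)
      · exact (Complex.imCLM.hasFDerivAt.comp_hasDerivAt x h)
      · simpa using hasDerivAt_const x (0 : ℝ)
    exact (PiLp.continuousLinearEquiv 2 ℝ (fun _ : Fin 3 => ℝ)).symm.hasFDerivAt.comp_hasDerivAt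
      x h4
  refine ⟨h3.differentiableAt.hasDerivAt, ?_⟩
  rw [h3.deriv, norm_vec]
  change ‖d‖ = _
  rw [hd, norm_mul, norm_mul, norm_pow, norm_blaschke_base, norm_div, norm_pow, norm_add_I_sq]
  simp [potential]
  ring

theorem norm_blaschke_sub_le (m : ℕ) (x y : ℝ) :
    ‖blaschke m x - blaschke m y‖ ≤ m * ‖blaschke 1 x - blaschke 1 y‖ := by
  induction m with
  | zero => simp [blaschke]
  | succ n ih =>
    have h : blaschke (n + 1) x - blaschke (n + 1) y =
        blaschke n x * (blaschke 1 x - blaschke 1 y) +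
          (blaschke n x - blaschke n y) * blaschke 1 y := by
      simp only [blaschke, pow_succ, pow_zero]
      ring
    have hx : ‖blaschke n x‖ = 1 := by simp only [blaschke, norm_pow, norm_blaschke_base, one_pow]
    have hy : ‖blaschke 1 y‖ = 1 := by simp only [blaschke, norm_pow, norm_blaschke_base, one_pow]
    rw [h]
    refine (norm_add_le _ _).trans ?_
    rw [norm_mul, norm_mul, hx, hy]
    push_cast
    linarith

theorem norm_blaschke_one_sub_sq (x y : ℝ) :
    ‖blaschke 1 x - blaschke 1 y‖ ^ 2 = 4 * |x - y| ^ 2 / ((1 + x ^ 2) * (1 + y ^ 2)) := by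
  have h : blaschke 1 x - blaschke 1 y =
      2 * Complex.I * ((x - y : ℝ) : ℂ) / (((x : ℂ) + Complex.I) * ((y : ℂ) + Complex.I)) := by
    have h1 := add_I_ne_zero x
    have h2 := add_I_ne_zero y
    simp only [blaschke, pow_one]
    push_cast
    field_simp
    ring
  rw [h, norm_div, norm_mul, norm_mul, norm_mul, div_pow, mul_pow, mul_pow, mul_pow, norm_add_I_sq,
    norm_add_I_sq, Complex.norm_real, Real.norm_eq_abs]
  simp
  norm_num [mul_pow]

theorem kernelR_nonneg (m : ℕ) (x y : ℝ) : 0 ≤ kernelR m x y := by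
  unfold kernelR
  positivity

theorem kernelR_le (m : ℕ) (x y : ℝ) :
    kernelR m x y ≤ 2 * m ^ 2 / Real.pi * ((1 + x ^ 2)⁻¹ * (1 + y ^ 2)⁻¹) := by
  rcases eq_or_ne x y with rfl | hxy
  · have h : kernelR m x x = 0 := by simp [kernelR]
    rw [h]
    positivity
  have hxy' : 0 < |x - y| ^ 2 := by
    have : 0 < |x - y| := abs_pos.2 (sub_ne_zero.2 hxy)
    positivity
  have h1 : ‖profile m x - profile m y‖ ^ 2 ≤
      m ^ 2 * (4 * |x - y| ^ 2 / ((1 + x ^ 2) * (1 + y ^ 2))) := by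
    rw [norm_profile_sub, ← norm_blaschke_one_sub_sq, ← mul_pow]
    gcongr
    exact norm_blaschke_sub_le m x y
  have h2 : ‖profile m x - profile m y‖ ^ 2 / |x - y| ^ 2 ≤
      4 * m ^ 2 * ((1 + x ^ 2)⁻¹ * (1 + y ^ 2)⁻¹) := by
    rw [div_le_iff₀ hxy']
    refine h1.trans (le_of_eq ?_)
    field_simp
  unfold kernelR
  calc 1 / (2 * Real.pi) * (‖profile m x - profile m y‖ ^ 2 / |x - y| ^ 2)
      ≤ 1 / (2 * Real.pi) * (4 * m ^ 2 * ((1 + x ^ 2)⁻¹ * (1 + y ^ 2)⁻¹)) := by gcongr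
    _ = _ := by
      field_simp
      ring

theorem measurable_blaschke (m : ℕ) : Measurable (blaschke m) := by
  unfold blaschke
  fun_prop

theorem measurable_kernelR (m : ℕ) : Measurable (Function.uncurry (kernelR m)) := by
  have h : Function.uncurry (kernelR m) = fun p : ℝ × ℝ =>
      1 / (2 * Real.pi) * (‖blaschke m p.1 - blaschke m p.2‖ ^ 2 / |p.1 - p.2| ^ 2) := by
    ext p
    simp only [Function.uncurry, kernelR, norm_profile_sub]
  have hb := measurable_blaschke m
  rw [h]
  fun_prop

theorem memLp_inv_one_add_sq : MemLp (fun x : ℝ => (1 + x ^ 2)⁻¹) 2 volume := by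
  rw [memLp_two_iff_integrable_sq (by fun_prop)]
  refine integrable_inv_one_add_sq.mono (by fun_prop) (Filter.Eventually.of_forall fun x => ?_)
  have h : (1 + x ^ 2)⁻¹ ≤ 1 := inv_le_one_of_one_le₀ (by nlinarith [sq_nonneg x])
  have h0 : 0 ≤ (1 + x ^ 2)⁻¹ := by positivity
  rw [Real.norm_of_nonneg h0, Real.norm_of_nonneg (by positivity)]
  nlinarith

theorem integrable_weight (f : L2) : Integrable (fun y : ℝ => (1 + y ^ 2)⁻¹ * ‖f y‖) volume :=
  MemLp.integrable_mul (p := 2) (q := 2) memLp_inv_one_add_sq (Lp.memLp f).norm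

theorem integrable_kernelR (m : ℕ) (f : L2) (x : ℝ) :
    Integrable (fun y => (kernelR m x y : ℂ) * f y) volume := by
  have hm : Measurable (kernelR m x) := (measurable_kernelR m).of_uncurry_left
  refine ((integrable_weight f).const_mul (2 * m ^ 2 / Real.pi * (1 + x ^ 2)⁻¹)).mono'
    ((Complex.measurable_ofReal.comp hm).aestronglyMeasurable.mul
      (Lp.memLp f).aestronglyMeasurable) (Filter.Eventually.of_forall fun y => ?_)
  rw [norm_mul, Complex.norm_real, Real.norm_of_nonneg (kernelR_nonneg m x y)]
  calc kernelR m x y * ‖f y‖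
      ≤ 2 * m ^ 2 / Real.pi * ((1 + x ^ 2)⁻¹ * (1 + y ^ 2)⁻¹) * ‖f y‖ := by
        gcongr
        exact kernelR_le m x y
    _ = _ := by ring

theorem memLp_integral_kernelR (m : ℕ) (f : L2) :
    MemLp (fun x => ∫ y, (kernelR m x y : ℂ) * f y) 2 volume := by
  have hmeas : AEStronglyMeasurable (fun x => ∫ y, (kernelR m x y : ℂ) * f y) volume := by
    have h1 : StronglyMeasurable (Function.uncurry fun x y : ℝ => (kernelR m x y : ℂ) * f y) := by
      refine Measurable.stronglyMeasurable ?_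
      exact (Complex.measurable_ofReal.comp (measurable_kernelR m)).mul
        ((Lp.stronglyMeasurable f).measurable.comp measurable_snd)
    exact h1.integral_prod_right.aestronglyMeasurable
  refine (memLp_inv_one_add_sq.const_mul
    (2 * m ^ 2 / Real.pi * ∫ y, (1 + y ^ 2)⁻¹ * ‖f y‖)).mono hmeas
    (Filter.Eventually.of_forall fun x => ?_)
  refine le_trans ?_ (le_abs_self _)
  calc ‖∫ y, (kernelR m x y : ℂ) * f y‖
      ≤ ∫ y, (2 * m ^ 2 / Real.pi * (1 + x ^ 2)⁻¹) * ((1 + y ^ 2)⁻¹ * ‖f y‖) := by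
        refine norm_integral_le_of_norm_le ((integrable_weight f).const_mul _)
          (Filter.Eventually.of_forall fun y => ?_)
        rw [norm_mul, Complex.norm_real, Real.norm_of_nonneg (kernelR_nonneg m x y)]
        calc kernelR m x y * ‖f y‖
            ≤ 2 * m ^ 2 / Real.pi * ((1 + x ^ 2)⁻¹ * (1 + y ^ 2)⁻¹) * ‖f y‖ := by
              gcongr
              exact kernelR_le m x y
          _ = _ := by ring
    _ = _ := by
      rw [integral_const_mul]
      ring

theorem memLp_potential_mul (m : ℕ) (f : L2) :
    MemLp (fun x => (potential m x : ℂ) * f x) 2 volume := by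
  have hm : Measurable fun x => (potential m x : ℂ) := by
    unfold potential
    fun_prop
  refine MemLp.of_le_mul (c := 2 * m) (Lp.memLp f)
    (hm.aestronglyMeasurable.mul (Lp.memLp f).aestronglyMeasurable)
    (Filter.Eventually.of_forall fun x => ?_)
  have h0 : 0 ≤ potential m x := by
    unfold potential
    positivity
  rw [norm_mul, Complex.norm_real, Real.norm_of_nonneg h0]
  gcongr
  exact div_le_self (by positivity) (by nlinarith [sq_nonneg x])

/-! ### The operators `L₊` and `L₋` -/

/-- Multiplication by the potential `2m / (1 + x²)`. -/
def mulPotential (m : ℕ) : L2 →ₗ[ℂ] L2 where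
  toFun f := (memLp_potential_mul m f).toLp _
  map_add' f g := by
    rw [← MemLp.toLp_add]
    refine MemLp.toLp_congr _ _ ?_
    filter_upwards [Lp.coeFn_add f g] with x hx
    rw [hx, Pi.add_apply, Pi.add_apply, mul_add]
  map_smul' c f := by
    rw [RingHom.id_apply, ← MemLp.toLp_const_smul]
    refine MemLp.toLp_congr _ _ ?_
    filter_upwards [Lp.coeFn_smul c f] with x hx
    rw [hx, Pi.smul_apply, Pi.smul_apply, smul_eq_mul, smul_eq_mul, mul_left_comm]

/-- The integral operator `R`,
`(R f)(x) = (1 / 2π) ∫ |𝐐_m(x) - 𝐐_m(y)|² / |x - y|² f(y) dy`. -/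
def opR (m : ℕ) : L2 →ₗ[ℂ] L2 where
  toFun f := (memLp_integral_kernelR m f).toLp _
  map_add' f g := by
    rw [← MemLp.toLp_add]
    refine MemLp.toLp_congr _ _ (Filter.Eventually.of_forall fun x => ?_)
    simp only [Pi.add_apply]
    rw [← integral_add (integrable_kernelR m f x) (integrable_kernelR m g x)]
    refine integral_congr_ae ?_
    filter_upwards [Lp.coeFn_add f g] with y hy
    rw [hy, Pi.add_apply, mul_add]
  map_smul' c f := by
    rw [RingHom.id_apply, ← MemLp.toLp_const_smul]
    refine MemLp.toLp_congr _ _ (Filter.Eventually.of_forall fun x => ?_)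
    simp only [Pi.smul_apply]
    rw [← integral_smul]
    refine integral_congr_ae ?_
    filter_upwards [Lp.coeFn_smul c f] with y hy
    rw [hy, Pi.smul_apply, smul_eq_mul, smul_eq_mul, mul_left_comm]

/-- `L₊ = |∇| - 2m / (1 + x²)` with domain `H¹(ℝ)`. -/
def opLplus (m : ℕ) : L2 →ₗ.[ℂ] L2 := (-mulPotential m) +ᵥ absNabla

/-- `L₋ = L₊ + R` with domain `H¹(ℝ)`. -/
def opLminus (m : ℕ) : L2 →ₗ.[ℂ] L2 := opR m +ᵥ opLplus m

end HalfWave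

end

noncomputable section

namespace HalfWave

open scoped FourierTransform SchwartzMap ComplexInnerProductSpace

/-! ### Identifying Fourier transforms by duality with Schwartz functions -/

/-! Both operators are a finite matrix plus a unitary copy of `|∇|`, and everything about the
spectrum is read off from that splitting.

Write B = (x - i)/(x + i) and e_j = B^j/(x + i). The Hardy spaces of positive and negative
frequencies are invariant under B and B⁻¹ respectively. On each of them `|∇|` is, up to sign, a
first-order derivative, so it obeys a Leibniz rule, and |B'| = 2/(1 + x²) gives |∇|(Bf) = B(|∇|f +
2f/(1 + x²)). Let W multiply the positive-frequency part by B^m and the negative-frequency part by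
B^(-m). Iterating the rule m times on both halves yields L₊W = W|∇| (`isNabla_shift`): the potential
is exactly the commutator. W is an isometry, and the orthogonal complement of its range is the span
K of the 2m functions e_j with -m ≤ j < m (`exists_eq_add_shift`, `inner_shift_eq_zero`).

The kernel of R is a Fejér kernel in B(x) and the conjugate of B(y), so R is a finite sum of
rank-one operators along d_p = e_(p-1) - e_p with weights proportional to m - |p| (`opR_eq`). Hence
R vanishes on the range of W and maps into K. Comparing coefficients on the e_j shows L₋ = 0 on K,
that is, L₊ = -R there (`isNabla_of_mem_modelSpace`). So L₊ is (-R on K) ⊕ |∇| and L₋ is 0 ⊕ |∇|,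
which is the content of `splits_opLplus` and `splits_opLminus`.

Since `|∇|` has spectrum [0, ∞) and no eigenvalue, the eigenvalues come from K alone and the
essential spectrum is the half-line. In the basis e_j the matrix of -R is tridiagonal with nonzero
off-diagonal entries, so its 2m eigenvalues are simple (`eq_zero_of_inner_first_eq_zero`). It is
nonpositive and kills the sum of all e_j, so the largest eigenvalue is 0. -/

theorem integral_mul_fourier (f : L2) (φ : 𝓢(ℝ, ℂ)) :
    ∫ ξ, φ ξ * (𝓕 f : L2) ξ = ∫ x, (𝓕 φ : 𝓢(ℝ, ℂ)) x * f x := by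
  have h := congrArg (fun T : 𝓢'(ℝ, ℂ) => T φ) (Lp.fourier_toTemperedDistribution_eq f)
  simpa [TemperedDistribution.fourier_apply] using h.symm

theorem ae_eq_of_integral_schwartz_mul {u v : ℝ → ℂ} (hu : LocallyIntegrable u)
    (hv : LocallyIntegrable v)
    (h : ∀ φ : 𝓢(ℝ, ℂ), ∫ x, φ x * u x = ∫ x, φ x * v x) : u =ᵐ[volume] v := by
  refine ae_eq_of_integral_contDiff_smul_eq hu hv fun g hg hc => ?_
  have h1 : HasCompactSupport (Complex.ofRealCLM ∘ g) := hc.comp_left rfl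
  have h2 : ContDiff ℝ (⊤ : ℕ∞) (Complex.ofRealCLM ∘ g) := by fun_prop
  simpa using h (h1.toSchwartzMap h2)

theorem locallyIntegrable_coe (f : L2) : LocallyIntegrable f :=
  (Lp.memLp f).locallyIntegrable (by norm_num)

theorem integrable_mul_of_memLp {u v : ℝ → ℂ} (hu : MemLp u 2) (hv : MemLp v 2) :
    Integrable (fun x => u x * v x) :=
  MemLp.integrable_mul (p := 2) (q := 2) hu hv

theorem memLp_schwartz (φ : 𝓢(ℝ, ℂ)) : MemLp φ 2 := φ.memLp 2

theorem memLp_comp_const_sub {u : ℝ → ℂ} (hu : MemLp u 2) (ξ : ℝ) :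
    MemLp (fun η => u (ξ - η)) 2 :=
  hu.comp_measurePreserving (Measure.measurePreserving_sub_left volume ξ)

theorem fourierInv_eq_integral (k : ℝ → ℂ) (x : ℝ) :
    𝓕⁻ k x = ∫ η : ℝ, Complex.exp (2 * Real.pi * η * x * Complex.I) * k η := by
  rw [Real.fourierInv_eq']
  refine integral_congr_ae (Filter.Eventually.of_forall fun η => ?_)
  simp only [smul_eq_mul]
  congr 2
  simp
  ring

theorem integral_fourierInv_mul {k g : ℝ → ℂ} (hk : Integrable k) (hg : Integrable g) :
    ∫ x, 𝓕⁻ k x * g x = ∫ η, k η * 𝓕⁻ g η := by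
  have h := VectorFourier.integral_fourierIntegral_smul_eq_flip (L := -innerₗ ℝ) (μ := volume)
    (ν := volume) Real.continuous_fourierChar
    (by simp only [LinearMap.neg_apply, innerₗ_apply_apply]; fun_prop) hk hg
  have h2 : (-innerₗ ℝ).flip = -innerₗ ℝ := by
    ext
    simp
  rw [h2] at h
  exact h

/-- Translation turns into modulation; this is what lets a product with `𝓕⁻ k` be recognised as an
average of translates, hence as a convolution. -/
theorem fourier_compSubConst (φ : 𝓢(ℝ, ℂ)) (a x : ℝ) :
    (𝓕 (φ.compSubConstCLM ℂ (-a)) : 𝓢(ℝ, ℂ)) x =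
      Complex.exp (2 * Real.pi * a * x * Complex.I) * (𝓕 φ : 𝓢(ℝ, ℂ)) x := by
  rw [SchwartzMap.fourier_coe, SchwartzMap.fourier_coe, Real.fourier_real_eq_integral_exp_smul,
    Real.fourier_real_eq_integral_exp_smul, ← integral_const_mul]
  rw [← integral_add_right_eq_self (fun v : ℝ => Complex.exp (2 * Real.pi * a * x * Complex.I) *
    Complex.exp (↑(-2 * Real.pi * v * x) * Complex.I) • φ v) a]
  refine integral_congr_ae (Filter.Eventually.of_forall fun v => ?_)
  simp only [SchwartzMap.compSubConstCLM_apply, sub_neg_eq_add, smul_eq_mul]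
  rw [← mul_assoc, ← Complex.exp_add]
  congr 2
  push_cast
  ring

/-- If `F` is the inverse Fourier transform of a function `k` in `L¹ ∩ L²`, then `k` is the
Fourier transform of `F`. -/
theorem fourier_ae_eq_of_eq_fourierInv {k : ℝ → ℂ} (hk : Integrable k) {F : L2}
    (hF : F =ᵐ[volume] 𝓕⁻ k) : (𝓕 F : L2) =ᵐ[volume] k := by
  refine ae_eq_of_integral_schwartz_mul (locallyIntegrable_coe _) hk.locallyIntegrable fun φ => ?_
  rw [integral_mul_fourier]
  have h1 : ∫ x, (𝓕 φ : 𝓢(ℝ, ℂ)) x * F x = ∫ x, 𝓕⁻ k x * (𝓕 φ : 𝓢(ℝ, ℂ)) x := by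
    refine integral_congr_ae ?_
    filter_upwards [hF] with x hx
    rw [hx, mul_comm]
  rw [h1, integral_fourierInv_mul hk (SchwartzMap.integrable _)]
  refine integral_congr_ae (Filter.Eventually.of_forall fun η => ?_)
  simp only
  rw [← SchwartzMap.fourierInv_coe, FourierTransform.fourierInv_fourier_eq, mul_comm]

theorem integrable_convolution_kernel {k : ℝ → ℂ} (hk2 : MemLp k 2) (G : L2) (ξ : ℝ) :
    Integrable (fun η => k (ξ - η) * G η) :=
  integrable_mul_of_memLp (memLp_comp_const_sub hk2 ξ) (Lp.memLp G)

/-- The convolution is bounded, by ab ≤ a² + b² and the two L² norms, which is all that testing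
against Schwartz functions requires. -/
theorem locallyIntegrable_convolution {k : ℝ → ℂ} (hk : Integrable k) (hk2 : MemLp k 2) (G : L2) :
    LocallyIntegrable (fun ξ => ∫ η, k (ξ - η) * G η) := by
  have hm : AEStronglyMeasurable (fun ξ => ∫ η, k (ξ - η) * G η) volume := by
    have h := AEStronglyMeasurable.convolution_integrand (μ := (volume : Measure ℝ))
      (ν := (volume : Measure ℝ)) (ContinuousLinearMap.mul ℂ ℂ).flip
      (Lp.aestronglyMeasurable G) hk.aestronglyMeasurable
    exact h.integral_prod_right'
  set C : ℝ := (∫ η, ‖k η‖ ^ 2) + ∫ η, ‖G η‖ ^ 2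
  have hk' : Integrable (fun η => ‖k η‖ ^ 2) := (memLp_two_iff_integrable_sq_norm hk2.1).1 hk2
  have hG' : Integrable (fun η => ‖G η‖ ^ 2) :=
    (memLp_two_iff_integrable_sq_norm (Lp.memLp G).1).1 (Lp.memLp G)
  refine ((locallyIntegrable_const C).mono hm (Filter.Eventually.of_forall fun ξ => ?_))
  have hk'' : Integrable (fun η => ‖k (ξ - η)‖ ^ 2) := hk'.comp_sub_left ξ
  have hC : ∫ η, (‖k (ξ - η)‖ ^ 2 + ‖G η‖ ^ 2) = C := by
    rw [integral_add hk'' hG', integral_sub_left_eq_self (fun η => ‖k η‖ ^ 2)]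
  refine le_trans ?_ (le_abs_self C)
  rw [← hC]
  refine norm_integral_le_of_norm_le (hk''.add hG') (Filter.Eventually.of_forall fun η => ?_)
  rw [norm_mul]
  nlinarith [sq_nonneg (‖k (ξ - η)‖ - ‖G η‖), norm_nonneg (k (ξ - η)), norm_nonneg (G η)]

/-- Fubini after a change of variables. The double integral converges absolutely because |φ k G| ≤
|k|(|φ|² + |G|²), and both products on the right are integrable with k in L¹ and φ, G in L². -/
theorem integral_integral_translate {k : ℝ → ℂ} (hk : Integrable k) (G : L2) (φ : 𝓢(ℝ, ℂ)) :
    ∫ η, k η * ∫ ξ, φ (ξ + η) * G ξ = ∫ ξ, φ ξ * ∫ η, k (ξ - η) * G η := by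
  have hφ' : Integrable (fun η => ‖φ η‖ ^ 2) :=
    (memLp_two_iff_integrable_sq_norm (memLp_schwartz φ).1).1 (memLp_schwartz φ)
  have hG' : Integrable (fun η => ‖G η‖ ^ 2) :=
    (memLp_two_iff_integrable_sq_norm (Lp.memLp G).1).1 (Lp.memLp G)
  have h1 := hφ'.mul_prod hk.norm
  have h2 := Integrable.convolution_integrand (μ := (volume : Measure ℝ))
      (ν := (volume : Measure ℝ)) (ContinuousLinearMap.mul ℝ ℝ) hk.norm hG'
  have hm := AEStronglyMeasurable.convolution_integrand (μ := (volume : Measure ℝ))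
      (ν := (volume : Measure ℝ)) (ContinuousLinearMap.mul ℂ ℂ)
      hk.aestronglyMeasurable (Lp.aestronglyMeasurable G)
  have hint : Integrable (fun p : ℝ × ℝ => φ p.1 * (k p.2 * G (p.1 - p.2)))
      (volume.prod volume) := by
    refine (h1.add h2).mono' ((φ.continuous.comp continuous_fst).aestronglyMeasurable.mul hm)
      (Filter.Eventually.of_forall fun p => ?_)
    simp only [norm_mul, Pi.add_apply, ContinuousLinearMap.mul_apply']
    have := mul_nonneg (norm_nonneg (k p.2))
      (add_nonneg (sq_nonneg (‖φ p.1‖ - ‖G (p.1 - p.2)‖)) (add_nonneg (sq_nonneg ‖φ p.1‖)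
        (sq_nonneg ‖G (p.1 - p.2)‖)))
    nlinarith
  have h3 : ∀ η, k η * ∫ ξ, φ (ξ + η) * G ξ = ∫ ξ, φ ξ * (k η * G (ξ - η)) := by
    intro η
    rw [← integral_const_mul, ← integral_add_right_eq_self (fun ξ => φ ξ * (k η * G (ξ - η))) η]
    refine integral_congr_ae (Filter.Eventually.of_forall fun ξ => ?_)
    simp only [add_sub_cancel_right]
    ring
  have h4 : ∀ ξ, φ ξ * ∫ η, k (ξ - η) * G η = ∫ η, φ ξ * (k η * G (ξ - η)) := by
    intro ξ
    rw [integral_const_mul, ← integral_sub_left_eq_self (fun η => k η * G (ξ - η)) volume ξ]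
    simp only [sub_sub_cancel]
  simp only [h3, h4]
  exact (integral_integral_swap (f := fun ξ η => φ ξ * (k η * G (ξ - η))) hint).symm

/-- Multiplication by `𝓕⁻ k` is convolution with `k` on the Fourier side. -/
theorem fourier_fourierInv_mul_ae_eq {k : ℝ → ℂ} (hk : Integrable k) (hk2 : MemLp k 2)
    {f F : L2} (hF : F =ᵐ[volume] fun x => 𝓕⁻ k x * f x) :
    (𝓕 F : L2) =ᵐ[volume] fun ξ => ∫ η, k (ξ - η) * (𝓕 f : L2) η := by
  refine ae_eq_of_integral_schwartz_mul (locallyIntegrable_coe _)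
    (locallyIntegrable_convolution hk hk2 _) fun φ => ?_
  have h1 : ∫ x, (𝓕 φ : 𝓢(ℝ, ℂ)) x * F x = ∫ x, 𝓕⁻ k x * ((𝓕 φ : 𝓢(ℝ, ℂ)) x * f x) := by
    refine integral_congr_ae ?_
    filter_upwards [hF] with x hx
    rw [hx]
    ring
  rw [integral_mul_fourier, h1, integral_fourierInv_mul hk
    (integrable_mul_of_memLp (memLp_schwartz _) (Lp.memLp f)), ← integral_integral_translate hk]
  refine integral_congr_ae (Filter.Eventually.of_forall fun η => ?_)
  have h2 := integral_mul_fourier f (φ.compSubConstCLM ℂ (-η))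
  simp only [SchwartzMap.compSubConstCLM_apply, sub_neg_eq_add] at h2
  simp only [h2, fourier_compSubConst, fourierInv_eq_integral]
  congr 1
  refine integral_congr_ae (Filter.Eventually.of_forall fun x => ?_)
  simp only
  rw [show (2 * Real.pi * η * x * Complex.I : ℂ) = 2 * Real.pi * x * η * Complex.I by ring]
  ring

/-! ### Bounded multiplication operators -/

/-- Bounded measurable functions. -/
def IsBddMeas (u : ℝ → ℂ) : Prop := Measurable u ∧ ∃ C, ∀ x, ‖u x‖ ≤ C

theorem IsBddMeas.memLp {u : ℝ → ℂ} (hu : IsBddMeas u) (f : L2) :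
    MemLp (fun x => u x * f x) 2 := by
  obtain ⟨h, C, hC⟩ := hu
  refine MemLp.of_le_mul (c := C) (Lp.memLp f)
    (h.aestronglyMeasurable.mul (Lp.memLp f).aestronglyMeasurable)
    (Filter.Eventually.of_forall fun x => ?_)
  rw [norm_mul]
  gcongr
  exact hC x

/-- Multiplication by a bounded measurable function on `L²`. -/
def mulL (u : ℝ → ℂ) (hu : IsBddMeas u) : L2 →L[ℂ] L2 :=
  LinearMap.mkContinuousOfExistsBound
    { toFun := fun f => (hu.memLp f).toLp _
      map_add' := fun f g => by
        rw [← MemLp.toLp_add]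
        refine MemLp.toLp_congr _ _ ?_
        filter_upwards [Lp.coeFn_add f g] with x hx
        rw [hx, Pi.add_apply, Pi.add_apply, mul_add]
      map_smul' := fun c f => by
        rw [RingHom.id_apply, ← MemLp.toLp_const_smul]
        refine MemLp.toLp_congr _ _ ?_
        filter_upwards [Lp.coeFn_smul c f] with x hx
        rw [hx, Pi.smul_apply, Pi.smul_apply, smul_eq_mul, smul_eq_mul, mul_left_comm] }
    (by
      obtain ⟨h, C, hC⟩ := hu
      refine ⟨C, fun f => Lp.norm_le_mul_norm_of_ae_le_mul ?_⟩
      filter_upwards [MemLp.coeFn_toLp (IsBddMeas.memLp ⟨h, C, hC⟩ f)] with x hx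
      change ‖((IsBddMeas.memLp ⟨h, C, hC⟩ f).toLp _ : L2) x‖ ≤ _
      rw [hx, norm_mul]
      gcongr
      exact hC x)

theorem mulL_ae (u : ℝ → ℂ) (hu : IsBddMeas u) (f : L2) :
    mulL u hu f =ᵐ[volume] fun x => u x * f x :=
  MemLp.coeFn_toLp (hu.memLp f)

/-! ### One-sided exponentials and their Fourier transforms -/

/-- The sign `σ = ±1` as a real number. -/
def sgn (σ : ℤˣ) : ℝ := ((σ : ℤ) : ℝ)

theorem sgn_one : sgn 1 = 1 := by simp [sgn]

theorem sgn_neg (σ : ℤˣ) : sgn (-σ) = -sgn σ := by simp [sgn]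

theorem sgn_mul_self (σ : ℤˣ) : sgn σ * sgn σ = 1 := by
  rcases Int.units_eq_one_or σ with rfl | rfl <;> simp [sgn]

theorem sgn_mul_self_complex (σ : ℤˣ) : (sgn σ : ℂ) * (sgn σ : ℂ) = 1 := by
  exact_mod_cast congrArg (fun r : ℝ => (r : ℂ)) (sgn_mul_self σ)

theorem abs_sgn (σ : ℤˣ) : |sgn σ| = 1 := by
  rcases Int.units_eq_one_or σ with rfl | rfl <;> simp [sgn]

theorem sgn_ne_zero (σ : ℤˣ) : sgn σ ≠ 0 := by
  intro h
  have := sgn_mul_self σ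
  simp [h] at this

theorem add_sgn_I_ne_zero (σ : ℤˣ) (x : ℝ) : (x : ℂ) + sgn σ * Complex.I ≠ 0 := by
  intro h
  have := congrArg Complex.im h
  simp [sgn_ne_zero] at this

theorem norm_add_sgn_I_sq (σ : ℤˣ) (x : ℝ) : ‖(x : ℂ) + sgn σ * Complex.I‖ ^ 2 = 1 + x ^ 2 := by
  rw [← Complex.normSq_eq_norm_sq, Complex.normSq_apply]
  simp
  rw [sgn_mul_self]
  ring

/-- The kernel `-2πi exp (-2πt)` on `t > 0`. -/
def expHalf : ℝ → ℂ :=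
  (Set.Ioi 0).indicator fun t => -(2 * Real.pi * Complex.I) * Complex.exp (-(2 * Real.pi) * t)

/-- The kernel `-4π² t exp (-2πt)` on `t > 0`. -/
def expHalfSq : ℝ → ℂ :=
  (Set.Ioi 0).indicator fun t => -(4 * Real.pi ^ 2) * t * Complex.exp (-(2 * Real.pi) * t)

theorem memLp_two_of_integrable_of_bdd {k : ℝ → ℂ} (hk : Integrable k) {C : ℝ}
    (hC : ∀ x, ‖k x‖ ≤ C) : MemLp k 2 := by
  rw [memLp_two_iff_integrable_sq_norm hk.1]
  refine (hk.norm.const_mul C).mono' (hk.1.norm.pow 2) (Filter.Eventually.of_forall fun x => ?_)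
  rw [norm_pow, norm_norm, sq]
  exact mul_le_mul_of_nonneg_right (hC x) (norm_nonneg _)

theorem integrable_expHalf : Integrable expHalf := by
  refine IntegrableOn.integrable_indicator ?_ measurableSet_Ioi
  refine Integrable.const_mul ?_ _
  exact integrableOn_exp_mul_complex_Ioi (by simp [Real.pi_pos]) 0

theorem norm_exp_neg_two_pi (t : ℝ) :
    ‖Complex.exp (-(2 * Real.pi) * t)‖ = Real.exp (-(2 * Real.pi) * t) := by
  rw [Complex.norm_exp]
  simp

theorem norm_expHalf_le (t : ℝ) : ‖expHalf t‖ ≤ 2 * Real.pi := by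
  have hpi := Real.pi_pos
  unfold expHalf
  rw [Set.indicator_apply]
  split_ifs with h
  · rw [norm_mul, norm_exp_neg_two_pi]
    have h1 : Real.exp (-(2 * Real.pi) * t) ≤ 1 := by
      rw [Real.exp_le_one_iff]
      have : 0 < t := h
      nlinarith [mul_pos hpi this]
    simp only [norm_neg, norm_mul, Complex.norm_ofNat, Complex.norm_real, Complex.norm_I, mul_one,
      Real.norm_eq_abs, abs_of_pos hpi]
    nlinarith
  · simp [hpi.le]

theorem norm_expHalfSq_le (t : ℝ) :
    ‖expHalfSq t‖ ≤ (Set.Ioi (0 : ℝ)).indicator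
      (fun t => 4 * Real.pi ^ 2 * Real.exp (-1 * t)) t := by
  have hpi := Real.pi_gt_three
  unfold expHalfSq
  rw [Set.indicator_apply, Set.indicator_apply]
  split_ifs with h
  · have ht : 0 < t := h
    rw [norm_mul, norm_exp_neg_two_pi]
    have h1 : t * Real.exp (-(2 * Real.pi) * t) ≤ Real.exp (-1 * t) := by
      calc t * Real.exp (-(2 * Real.pi) * t)
          ≤ Real.exp t * Real.exp (-(2 * Real.pi) * t) := by
            gcongr
            linarith [Real.add_one_le_exp t]
        _ = Real.exp (t + -(2 * Real.pi) * t) := (Real.exp_add _ _).symm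
        _ ≤ _ := by
          rw [Real.exp_le_exp]
          nlinarith
    simp only [norm_neg, norm_mul, Complex.norm_ofNat, Complex.norm_real, norm_pow,
      Real.norm_eq_abs, abs_of_pos ht, sq_abs]
    rw [mul_assoc]
    gcongr
  · simp

theorem integrable_expHalfSq : Integrable expHalfSq := by
  have h : Integrable ((Set.Ioi (0 : ℝ)).indicator
      (fun t => 4 * Real.pi ^ 2 * Real.exp (-1 * t))) :=
    IntegrableOn.integrable_indicator
      (Integrable.const_mul (integrableOn_exp_mul_Ioi (by norm_num) 0) _) measurableSet_Ioi
  refine h.mono' ?_ (Filter.Eventually.of_forall norm_expHalfSq_le)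
  refine (Measurable.indicator ?_ measurableSet_Ioi).aestronglyMeasurable
  fun_prop

theorem norm_expHalfSq_le_const (t : ℝ) : ‖expHalfSq t‖ ≤ 4 * Real.pi ^ 2 := by
  refine (norm_expHalfSq_le t).trans ?_
  rw [Set.indicator_apply]
  split_ifs with h
  · have ht : 0 < t := h
    have : Real.exp (-1 * t) ≤ 1 := by
      rw [Real.exp_le_one_iff]
      linarith
    nlinarith [sq_nonneg Real.pi]
  · positivity

/-- The integral of exp(at) over the positive half-line is -1/a; here a = 2πi(y + i), and the factor
-2πi in `expHalf` normalises the result. -/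
theorem integral_exp_mul_expHalf (y : ℝ) :
    ∫ t : ℝ, Complex.exp (2 * Real.pi * t * y * Complex.I) * expHalf t =
      ((y : ℂ) + Complex.I)⁻¹ := by
  have hpi : (Real.pi : ℂ) ≠ 0 := by exact_mod_cast Real.pi_ne_zero
  set a : ℂ := 2 * Real.pi * y * Complex.I - 2 * Real.pi with ha
  have hre : a.re < 0 := by simp [ha, Real.pi_pos]
  have h0 : a = 2 * Real.pi * Complex.I * (y + Complex.I) := by
    rw [ha]
    linear_combination (-2 * Real.pi : ℂ) * Complex.I_sq
  have h1 : ∀ t : ℝ, Complex.exp (2 * Real.pi * t * y * Complex.I) * expHalf t =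
      (Set.Ioi (0 : ℝ)).indicator
        (fun t : ℝ => -(2 * Real.pi * Complex.I) * Complex.exp (a * t)) t := by
    intro t
    unfold expHalf
    rw [Set.indicator_apply, Set.indicator_apply]
    split_ifs
    · rw [mul_left_comm, ← Complex.exp_add]
      congr 2
      rw [ha]
      ring
    · simp
  simp only [h1]
  rw [integral_indicator measurableSet_Ioi, integral_const_mul,
    integral_exp_mul_complex_Ioi hre 0, h0]
  have := add_I_ne_zero y
  have := Complex.I_ne_zero
  simp
  field_simp

theorem tendsto_mul_exp_atTop {a : ℂ} (ha : a.re < 0) :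
    Filter.Tendsto (fun t : ℝ => ((t : ℂ) / a - 1 / a ^ 2) * Complex.exp (a * t)) Filter.atTop
      (nhds 0) := by
  have h1 : Filter.Tendsto (fun t : ℝ => Complex.exp (a * t)) Filter.atTop (nhds 0) := by
    rw [tendsto_zero_iff_norm_tendsto_zero]
    have h := (tendsto_rpow_mul_exp_neg_mul_atTop_nhds_zero 0 (-a.re) (by linarith))
    simpa [Complex.norm_exp] using h
  have h2 : Filter.Tendsto (fun t : ℝ => (t : ℂ) * Complex.exp (a * t)) Filter.atTop (nhds 0) := by
    rw [tendsto_zero_iff_norm_tendsto_zero]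
    have h := (tendsto_rpow_mul_exp_neg_mul_atTop_nhds_zero 1 (-a.re) (by linarith)).norm
    simpa [Complex.norm_exp] using h
  have h3 := (h2.mul_const (1 / a)).sub (h1.mul_const (1 / a ^ 2))
  simp only [zero_mul, sub_zero] at h3
  refine h3.congr fun t => ?_
  ring

theorem integral_exp_mul_expHalfSq (y : ℝ) :
    ∫ t : ℝ, Complex.exp (2 * Real.pi * t * y * Complex.I) * expHalfSq t =
      (((y : ℂ) + Complex.I)⁻¹) ^ 2 := by
  have hpi : (Real.pi : ℂ) ≠ 0 := by exact_mod_cast Real.pi_ne_zero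
  set a : ℂ := 2 * Real.pi * y * Complex.I - 2 * Real.pi with ha
  have hre : a.re < 0 := by simp [ha, Real.pi_pos]
  have h0 : a = 2 * Real.pi * Complex.I * (y + Complex.I) := by
    rw [ha]
    linear_combination (-2 * Real.pi : ℂ) * Complex.I_sq
  have ha0 : a ≠ 0 := fun h => by simp [h] at hre
  have h1 : ∀ t : ℝ, Complex.exp (2 * Real.pi * t * y * Complex.I) * expHalfSq t =
      (Set.Ioi (0 : ℝ)).indicator
        (fun t : ℝ => -(4 * Real.pi ^ 2) * (t * Complex.exp (a * t))) t := by
    intro t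
    unfold expHalfSq
    rw [Set.indicator_apply, Set.indicator_apply]
    split_ifs
    · rw [mul_left_comm, ← Complex.exp_add, mul_assoc]
      congr 4
      rw [ha]
      ring
    · simp
  have hint : IntegrableOn (fun t : ℝ => (t : ℂ) * Complex.exp (a * t)) (Set.Ioi 0) := by
    have h := integrable_expHalfSq.bdd_mul
      (f := fun t : ℝ => Complex.exp (2 * Real.pi * t * y * Complex.I)) (c := 1)
      (by fun_prop) (Filter.Eventually.of_forall fun t => by simp [Complex.norm_exp])
    simp only [h1] at h
    have h2 := ((integrable_indicator_iff measurableSet_Ioi).1 h).const_mul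
      (-(4 * Real.pi ^ 2 : ℂ))⁻¹
    refine h2.congr (Filter.Eventually.of_forall fun t => ?_)
    field_simp
  -- The antiderivative of t exp(at) found by parts; it vanishes at infinity and equals -1/a² at 0.
  have hd : ∀ t ∈ Set.Ici (0 : ℝ), HasDerivAt
      (fun t : ℝ => ((t : ℂ) / a - 1 / a ^ 2) * Complex.exp (a * t))
      ((t : ℂ) * Complex.exp (a * t)) t := by
    intro t _
    have e1 : HasDerivAt (fun t : ℝ => (t : ℂ)) 1 t := Complex.ofRealCLM.hasDerivAt
    have e2 := ((e1.div_const a).sub_const (1 / a ^ 2)).mul ((e1.const_mul a).cexp)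
    refine e2.congr_deriv ?_
    field_simp
    ring
  simp only [h1]
  rw [integral_indicator measurableSet_Ioi, integral_const_mul,
    integral_Ioi_of_hasDerivAt_of_tendsto' hd hint (tendsto_mul_exp_atTop hre), h0]
  have := add_I_ne_zero y
  have := Complex.I_ne_zero
  simp
  field_simp
  norm_num

/-- The Fourier transform of `1 / (x + σ i)`. -/
def expKernel (σ : ℤˣ) (ξ : ℝ) : ℂ := sgn σ * expHalf (sgn σ * ξ)

/-- The Fourier transform of `1 / (x + σ i) ^ 2`. -/
def expKernelSq (σ : ℤˣ) (ξ : ℝ) : ℂ := expHalfSq (sgn σ * ξ)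

theorem integrable_expKernel (σ : ℤˣ) : Integrable (expKernel σ) :=
  (integrable_expHalf.comp_mul_left' (sgn_ne_zero σ)).const_mul _

theorem integrable_expKernelSq (σ : ℤˣ) : Integrable (expKernelSq σ) :=
  integrable_expHalfSq.comp_mul_left' (sgn_ne_zero σ)

theorem memLp_expKernel (σ : ℤˣ) : MemLp (expKernel σ) 2 :=
  memLp_two_of_integrable_of_bdd (integrable_expKernel σ) (C := 2 * Real.pi) fun x => by
    unfold expKernel
    rw [norm_mul, Complex.norm_real, Real.norm_eq_abs, abs_sgn, one_mul]
    exact norm_expHalf_le _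

theorem memLp_expKernelSq (σ : ℤˣ) : MemLp (expKernelSq σ) 2 :=
  memLp_two_of_integrable_of_bdd (integrable_expKernelSq σ) fun _ => norm_expHalfSq_le_const _

theorem fourierInv_comp_sgn_mul (σ : ℤˣ) (k : ℝ → ℂ) (x : ℝ) :
    𝓕⁻ (fun ξ => k (sgn σ * ξ)) x =
      ∫ t : ℝ, Complex.exp (2 * Real.pi * t * (sgn σ * x : ℝ) * Complex.I) * k t := by
  rw [fourierInv_eq_integral]
  have h := Measure.integral_comp_mul_left
    (fun t : ℝ => Complex.exp (2 * Real.pi * t * (sgn σ * x : ℝ) * Complex.I) * k t) (sgn σ)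
  rw [abs_inv, abs_sgn, inv_one, one_smul] at h
  rw [← h]
  refine integral_congr_ae (Filter.Eventually.of_forall fun η => ?_)
  simp only
  congr 2
  push_cast
  linear_combination (-2 * Real.pi * η * x * Complex.I : ℂ) * sgn_mul_self_complex σ

theorem sgn_mul_inv (σ : ℤˣ) (x : ℝ) :
    (((sgn σ * x : ℝ) : ℂ) + Complex.I)⁻¹ = sgn σ * ((x : ℂ) + sgn σ * Complex.I)⁻¹ := by
  have h1 := add_sgn_I_ne_zero σ x
  have h2 := add_I_ne_zero (sgn σ * x)
  rw [← div_eq_mul_inv, eq_div_iff h1, inv_mul_eq_iff_eq_mul₀ h2]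
  push_cast
  linear_combination (-(x : ℂ)) * sgn_mul_self_complex σ

theorem fourierInv_expKernel (σ : ℤˣ) (x : ℝ) :
    𝓕⁻ (expKernel σ) x = ((x : ℂ) + sgn σ * Complex.I)⁻¹ := by
  have h := fourierInv_comp_sgn_mul σ (fun t => sgn σ * expHalf t) x
  simp only [mul_left_comm _ (sgn σ : ℂ)] at h
  rw [integral_const_mul, integral_exp_mul_expHalf, sgn_mul_inv, ← mul_assoc,
    sgn_mul_self_complex, one_mul] at h
  exact h

theorem fourierInv_expKernelSq (σ : ℤˣ) (x : ℝ) :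
    𝓕⁻ (expKernelSq σ) x = (((x : ℂ) + sgn σ * Complex.I)⁻¹) ^ 2 := by
  have h := fourierInv_comp_sgn_mul σ expHalfSq x
  rw [integral_exp_mul_expHalfSq, sgn_mul_inv, mul_pow, sq (sgn σ : ℂ),
    sgn_mul_self_complex, one_mul] at h
  exact h

/-! ### Multiplication by `1 / (x + σ i)` and Hardy spaces -/

theorem norm_inv_add_sgn_I_le (σ : ℤˣ) (x : ℝ) : ‖((x : ℂ) + sgn σ * Complex.I)⁻¹‖ ≤ 1 := by
  rw [norm_inv]
  refine inv_le_one_of_one_le₀ ?_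
  nlinarith [norm_add_sgn_I_sq σ x, norm_nonneg ((x : ℂ) + sgn σ * Complex.I), sq_nonneg x]

theorem isBddMeas_inv (σ : ℤˣ) : IsBddMeas fun x : ℝ => ((x : ℂ) + sgn σ * Complex.I)⁻¹ :=
  ⟨by fun_prop, 1, norm_inv_add_sgn_I_le σ⟩

/-- Multiplication by `1 / (x + σ i)`. -/
def cauchy (σ : ℤˣ) : L2 →L[ℂ] L2 := mulL _ (isBddMeas_inv σ)

theorem cauchy_ae (σ : ℤˣ) (f : L2) :
    cauchy σ f =ᵐ[volume] fun x : ℝ => ((x : ℂ) + sgn σ * Complex.I)⁻¹ * f x :=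
  mulL_ae _ _ f

theorem fourier_cauchy (σ : ℤˣ) (f : L2) :
    (𝓕 (cauchy σ f) : L2) =ᵐ[volume] fun ξ => ∫ η, expKernel σ (ξ - η) * (𝓕 f : L2) η := by
  refine fourier_fourierInv_mul_ae_eq (integrable_expKernel σ) (memLp_expKernel σ) ?_
  simpa only [fourierInv_expKernel] using cauchy_ae σ f

theorem fourier_cauchy_cauchy (σ : ℤˣ) (f : L2) :
    (𝓕 (cauchy σ (cauchy σ f)) : L2) =ᵐ[volume]
      fun ξ => ∫ η, expKernelSq σ (ξ - η) * (𝓕 f : L2) η := by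
  refine fourier_fourierInv_mul_ae_eq (integrable_expKernelSq σ) (memLp_expKernelSq σ) ?_
  filter_upwards [cauchy_ae σ (cauchy σ f), cauchy_ae σ f] with x h1 h2
  rw [h1, h2, fourierInv_expKernelSq]
  ring

theorem memLp_inv_add_sgn_I (σ : ℤˣ) :
    MemLp (fun x : ℝ => ((x : ℂ) + sgn σ * Complex.I)⁻¹) 2 := by
  rw [memLp_two_iff_integrable_sq_norm (by fun_prop)]
  refine integrable_inv_one_add_sq.congr (Filter.Eventually.of_forall fun x => ?_)
  simp only
  rw [norm_inv, inv_pow, norm_add_sgn_I_sq]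

/-- The function `1 / (x + σ i)` in `L²`. -/
def cauchyFun (σ : ℤˣ) : L2 := (memLp_inv_add_sgn_I σ).toLp _

theorem cauchyFun_ae (σ : ℤˣ) :
    cauchyFun σ =ᵐ[volume] fun x : ℝ => ((x : ℂ) + sgn σ * Complex.I)⁻¹ :=
  MemLp.coeFn_toLp _

theorem fourier_cauchyFun (σ : ℤˣ) : (𝓕 (cauchyFun σ) : L2) =ᵐ[volume] expKernel σ := by
  refine fourier_ae_eq_of_eq_fourierInv (integrable_expKernel σ) ?_
  filter_upwards [cauchyFun_ae σ] with x hx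
  rw [hx, fourierInv_expKernel]

theorem fourier_cauchy_cauchyFun (σ : ℤˣ) :
    (𝓕 (cauchy σ (cauchyFun σ)) : L2) =ᵐ[volume] expKernelSq σ := by
  refine fourier_ae_eq_of_eq_fourierInv (integrable_expKernelSq σ) ?_
  filter_upwards [cauchyFun_ae σ, cauchy_ae σ (cauchyFun σ)] with x h1 h2
  rw [h2, h1, fourierInv_expKernelSq]
  ring

theorem expKernel_of_nonpos {σ : ℤˣ} {ξ : ℝ} (h : sgn σ * ξ ≤ 0) : expKernel σ ξ = 0 := by
  unfold expKernel expHalf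
  rw [Set.indicator_of_notMem (by simpa using h), mul_zero]

theorem expKernelSq_of_nonpos {σ : ℤˣ} {ξ : ℝ} (h : sgn σ * ξ ≤ 0) : expKernelSq σ ξ = 0 := by
  unfold expKernelSq expHalfSq
  rw [Set.indicator_of_notMem (by simpa using h)]

theorem expKernel_of_pos {σ : ℤˣ} {ξ : ℝ} (h : 0 < sgn σ * ξ) : expKernel σ ξ =
    sgn σ * (-(2 * Real.pi * Complex.I) * Complex.exp (-(2 * Real.pi) * (sgn σ * ξ : ℝ))) := by
  unfold expKernel expHalf
  rw [Set.indicator_of_mem (by simpa using h)]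

theorem expKernelSq_of_pos {σ : ℤˣ} {ξ : ℝ} (h : 0 < sgn σ * ξ) : expKernelSq σ ξ =
    -(4 * Real.pi ^ 2) * (sgn σ * ξ : ℝ) * Complex.exp (-(2 * Real.pi) * (sgn σ * ξ : ℝ)) := by
  unfold expKernelSq expHalfSq
  rw [Set.indicator_of_mem (by simpa using h)]

/-- The Fourier-side form of -i d/dx (x + σi)⁻¹ = i (x + σi)⁻². -/
theorem two_pi_mul_expKernel (σ : ℤˣ) (ξ : ℝ) :
    2 * Real.pi * ξ * expKernel σ ξ = Complex.I * expKernelSq σ ξ := by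
  rcases le_or_gt (sgn σ * ξ) 0 with h | h
  · rw [expKernel_of_nonpos h, expKernelSq_of_nonpos h, mul_zero, mul_zero]
  · rw [expKernel_of_pos h, expKernelSq_of_pos h]
    push_cast
    ring

/-- The Hardy space of functions whose Fourier transform is supported on `σ ξ ≥ 0`. -/
def hardy (σ : ℤˣ) : Submodule ℂ L2 where
  carrier := {f | ∀ᵐ ξ : ℝ, sgn σ * ξ < 0 → (𝓕 f : L2) ξ = 0}
  zero_mem' := by
    have h : (𝓕 (0 : L2) : L2) = 0 := (Lp.fourierTransformₗᵢ ℝ ℂ).map_zero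
    rw [Set.mem_ofPred_eq, h]
    filter_upwards [Lp.coeFn_zero ℂ 2 (volume : Measure ℝ)] with ξ hξ _
    exact hξ
  add_mem' := by
    intro f g hf hg
    have h : (𝓕 (f + g) : L2) = 𝓕 f + 𝓕 g := (Lp.fourierTransformₗᵢ ℝ ℂ).map_add f g
    rw [Set.mem_ofPred_eq, h]
    filter_upwards [hf, hg, Lp.coeFn_add (𝓕 f : L2) (𝓕 g)] with ξ h1 h2 h3 h4
    rw [h3, Pi.add_apply, h1 h4, h2 h4, add_zero]
  smul_mem' := by
    intro c f hf
    have h : (𝓕 (c • f) : L2) = c • 𝓕 f := (Lp.fourierTransformₗᵢ ℝ ℂ).map_smul c f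
    rw [Set.mem_ofPred_eq, h]
    filter_upwards [hf, Lp.coeFn_smul c (𝓕 f : L2)] with ξ h1 h2 h3
    rw [h2, Pi.smul_apply, h1 h3, smul_zero]

theorem mem_hardy {σ : ℤˣ} {f : L2} :
    f ∈ hardy σ ↔ ∀ᵐ ξ : ℝ, sgn σ * ξ < 0 → (𝓕 f : L2) ξ = 0 := Iff.rfl

theorem cauchyFun_mem_hardy (σ : ℤˣ) : cauchyFun σ ∈ hardy σ := by
  rw [mem_hardy]
  filter_upwards [fourier_cauchyFun σ] with ξ h1 h2
  rw [h1, expKernel_of_nonpos h2.le]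

theorem cauchy_mem_hardy {σ : ℤˣ} {f : L2} (hf : f ∈ hardy σ) : cauchy σ f ∈ hardy σ := by
  rw [mem_hardy] at hf ⊢
  filter_upwards [fourier_cauchy σ f] with ξ h1 h2
  rw [h1]
  refine integral_eq_zero_of_ae ?_
  filter_upwards [hf] with η h3
  rcases lt_or_ge (sgn σ * η) 0 with h | h
  · simp [h3 h]
  · rw [expKernel_of_nonpos (by nlinarith), zero_mul, Pi.zero_apply]

/-! ### `|∇|` as a relation, and its Leibniz rule on Hardy spaces -/

theorem ae_ne_zero : ∀ᵐ ξ : ℝ, ξ ≠ 0 := by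
  simp [ae_iff, measure_singleton]

/-- `g = |∇| f`. -/
def IsNabla (f g : L2) : Prop := (𝓕 g : L2) =ᵐ[volume] fun ξ => absSymbol ξ * (𝓕 f : L2) ξ

theorem IsNabla.add {f g f' g' : L2} (h : IsNabla f g) (h' : IsNabla f' g') :
    IsNabla (f + f') (g + g') := by
  have e1 : (𝓕 (f + f') : L2) = 𝓕 f + 𝓕 f' := (Lp.fourierTransformₗᵢ ℝ ℂ).map_add f f'
  have e2 : (𝓕 (g + g') : L2) = 𝓕 g + 𝓕 g' := (Lp.fourierTransformₗᵢ ℝ ℂ).map_add g g'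
  unfold IsNabla
  rw [e1, e2]
  filter_upwards [h, h', Lp.coeFn_add (𝓕 f : L2) (𝓕 f'), Lp.coeFn_add (𝓕 g : L2) (𝓕 g')]
    with ξ h1 h2 h3 h4
  rw [h3, h4, Pi.add_apply, Pi.add_apply, h1, h2, mul_add]

theorem IsNabla.smul {f g : L2} (c : ℂ) (h : IsNabla f g) : IsNabla (c • f) (c • g) := by
  have e1 : (𝓕 (c • f) : L2) = c • 𝓕 f := (Lp.fourierTransformₗᵢ ℝ ℂ).map_smul c f
  have e2 : (𝓕 (c • g) : L2) = c • 𝓕 g := (Lp.fourierTransformₗᵢ ℝ ℂ).map_smul c g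
  unfold IsNabla
  rw [e1, e2]
  filter_upwards [h, Lp.coeFn_smul c (𝓕 f : L2), Lp.coeFn_smul c (𝓕 g : L2)] with ξ h1 h2 h3
  rw [h2, h3, Pi.smul_apply, Pi.smul_apply, h1, smul_eq_mul, smul_eq_mul, mul_left_comm]

theorem IsNabla.sub {f g f' g' : L2} (h : IsNabla f g) (h' : IsNabla f' g') :
    IsNabla (f - f') (g - g') := by
  simpa [sub_eq_add_neg] using h.add (h'.smul (-1))

theorem isNabla_cauchyFun (σ : ℤˣ) :
    IsNabla (cauchyFun σ) ((sgn σ * Complex.I) • cauchy σ (cauchyFun σ)) := by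
  have e : (𝓕 ((sgn σ * Complex.I) • cauchy σ (cauchyFun σ)) : L2) =
      (sgn σ * Complex.I) • 𝓕 (cauchy σ (cauchyFun σ)) :=
    (Lp.fourierTransformₗᵢ ℝ ℂ).map_smul _ _
  unfold IsNabla
  rw [e]
  filter_upwards [fourier_cauchyFun σ, fourier_cauchy_cauchyFun σ,
    Lp.coeFn_smul (sgn σ * Complex.I) (𝓕 (cauchy σ (cauchyFun σ)) : L2)] with ξ h1 h2 h3
  rw [h3, Pi.smul_apply, h1, h2, smul_eq_mul, mul_assoc, ← two_pi_mul_expKernel]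
  rcases le_or_gt (sgn σ * ξ) 0 with h | h
  · simp [expKernel_of_nonpos h]
  · have h4 : |ξ| = sgn σ * ξ := by
      rw [← abs_of_pos h, abs_mul, abs_sgn, one_mul]
    rw [absSymbol, h4]
    push_cast
    ring

/-- If ξ - η and η lie on the same half-line, then |ξ| = |ξ - η| + |η|. Inserted in the convolution
integral this is a Leibniz rule; the second term differentiates the factor 1/(x + σi). It fails
without the one-sided support of both factors. -/
theorem isNabla_cauchy {σ : ℤˣ} {f g : L2} (hf : f ∈ hardy σ) (h : IsNabla f g) :
    IsNabla (cauchy σ f) (cauchy σ g + (sgn σ * Complex.I) • cauchy σ (cauchy σ f)) := by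
  have e1 : (𝓕 (cauchy σ g + (sgn σ * Complex.I) • cauchy σ (cauchy σ f)) : L2) =
      𝓕 (cauchy σ g) + (sgn σ * Complex.I) • 𝓕 (cauchy σ (cauchy σ f)) := by
    have h1 := (Lp.fourierTransformₗᵢ ℝ ℂ).map_add (cauchy σ g)
      ((sgn σ * Complex.I) • cauchy σ (cauchy σ f))
    rw [(Lp.fourierTransformₗᵢ ℝ ℂ).map_smul] at h1
    exact h1
  unfold IsNabla
  rw [e1]
  filter_upwards [fourier_cauchy σ f, fourier_cauchy σ g, fourier_cauchy_cauchy σ f,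
    Lp.coeFn_add (𝓕 (cauchy σ g)) ((sgn σ * Complex.I) • 𝓕 (cauchy σ (cauchy σ f)) : L2),
    Lp.coeFn_smul (sgn σ * Complex.I) (𝓕 (cauchy σ (cauchy σ f)) : L2)] with ξ h1 h2 h3 h4 h5
  rw [h4, Pi.add_apply, h5, Pi.smul_apply, h1, h2, h3, smul_eq_mul, ← integral_const_mul,
    ← integral_const_mul, ← integral_add (integrable_convolution_kernel (memLp_expKernel σ) _ ξ)
    ((integrable_convolution_kernel (memLp_expKernelSq σ) _ ξ).const_mul _)]
  refine integral_congr_ae ?_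
  filter_upwards [h, mem_hardy.1 hf] with η h6 h7
  rw [h6, mul_assoc, ← mul_assoc Complex.I, ← two_pi_mul_expKernel]
  rcases lt_or_ge (sgn σ * η) 0 with h | h
  · simp [h7 h]
  rcases le_or_gt (sgn σ * (ξ - η)) 0 with h' | h'
  · simp [expKernel_of_nonpos h']
  have h8 : |ξ| = sgn σ * ξ := by
    rw [← one_mul |ξ|, ← abs_sgn σ, ← abs_mul, abs_of_nonneg (by linarith)]
  have h9 : |η| = sgn σ * η := by
    rw [← one_mul |η|, ← abs_sgn σ, ← abs_mul, abs_of_nonneg h]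
  rw [absSymbol, absSymbol, h8, h9]
  push_cast
  ring

/-- Dividing by x - σi creates a single pole. At frequencies of the wrong sign the exponential
kernel in ξ - η factors into a function of ξ times a function of η, so the part outside the Hardy
space is a multiple of one fixed function. -/
theorem exists_cauchy_neg_sub_smul_mem_hardy {σ : ℤˣ} {f : L2} (hf : f ∈ hardy σ) :
    ∃ c : ℂ, cauchy (-σ) f - c • cauchyFun (-σ) ∈ hardy σ := by
  -- The constant is the residue at the pole: the value at σi of the holomorphic extension of f.
  refine ⟨∫ η, Complex.exp (-(2 * Real.pi) * (sgn σ * η : ℝ)) * (𝓕 f : L2) η, ?_⟩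
  set c := ∫ η : ℝ, Complex.exp (-(2 * Real.pi) * (sgn σ * η : ℝ)) * (𝓕 f : L2) η
  have e : (𝓕 (cauchy (-σ) f - c • cauchyFun (-σ)) : L2) =
      𝓕 (cauchy (-σ) f) - c • 𝓕 (cauchyFun (-σ)) := by
    have h1 := (Lp.fourierTransformₗᵢ ℝ ℂ).map_sub (cauchy (-σ) f) (c • cauchyFun (-σ))
    rw [(Lp.fourierTransformₗᵢ ℝ ℂ).map_smul] at h1
    exact h1
  rw [mem_hardy, e]
  filter_upwards [fourier_cauchy (-σ) f, fourier_cauchyFun (-σ),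
    Lp.coeFn_sub (𝓕 (cauchy (-σ) f) : L2) (c • 𝓕 (cauchyFun (-σ)) : L2),
    Lp.coeFn_smul c (𝓕 (cauchyFun (-σ)) : L2)] with ξ h1 h2 h3 h4 hξ
  rw [h3, Pi.sub_apply, h4, Pi.smul_apply, h1, h2, smul_eq_mul, sub_eq_zero, mul_comm,
    ← integral_const_mul]
  refine integral_congr_ae ?_
  filter_upwards [mem_hardy.1 hf] with η h7
  rcases lt_or_ge (sgn σ * η) 0 with h | h
  · simp [h7 h]
  have h8 : Complex.exp (-(2 * Real.pi) * (sgn (-σ) * (ξ - η) : ℝ)) =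
      Complex.exp (-(2 * Real.pi) * (sgn (-σ) * ξ : ℝ)) *
        Complex.exp (-(2 * Real.pi) * (sgn σ * η : ℝ)) := by
    rw [← Complex.exp_add, sgn_neg]
    congr 1
    push_cast
    ring
  rw [expKernel_of_pos (by rw [sgn_neg]; linarith), expKernel_of_pos (by rw [sgn_neg]; linarith),
    h8]
  ring

/-! ### The unitary multiplication operators by `(x - σ i) / (x + σ i)` -/

/-- The Blaschke factor `(x - σ i) / (x + σ i)`. -/
def factor (σ : ℤˣ) (x : ℝ) : ℂ :=
  ((x : ℂ) - sgn σ * Complex.I) / ((x : ℂ) + sgn σ * Complex.I)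

theorem sub_sgn_I_ne_zero (σ : ℤˣ) (x : ℝ) : (x : ℂ) - sgn σ * Complex.I ≠ 0 := by
  have h := add_sgn_I_ne_zero (-σ) x
  rwa [sgn_neg, Complex.ofReal_neg, neg_mul, ← sub_eq_add_neg] at h

theorem norm_factor (σ : ℤˣ) (x : ℝ) : ‖factor σ x‖ = 1 := by
  have h : ‖(x : ℂ) - sgn σ * Complex.I‖ = ‖(x : ℂ) + sgn σ * Complex.I‖ := by
    rw [← Complex.norm_conj ((x : ℂ) + sgn σ * Complex.I)]
    simp [sub_eq_add_neg]
  rw [factor, norm_div, h, div_self (norm_ne_zero_iff.2 (add_sgn_I_ne_zero σ x))]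

theorem factor_neg_mul (σ : ℤˣ) (x : ℝ) : factor (-σ) x * factor σ x = 1 := by
  have h1 := add_sgn_I_ne_zero σ x
  have h2 := sub_sgn_I_ne_zero σ x
  simp only [factor, sgn_neg, Complex.ofReal_neg, neg_mul, sub_neg_eq_add]
  rw [← sub_eq_add_neg]
  field_simp

theorem conj_factor (σ : ℤˣ) (x : ℝ) : (starRingEnd ℂ) (factor σ x) = factor (-σ) x := by
  simp [factor, sgn_neg, sub_eq_add_neg]

theorem isBddMeas_factor (σ : ℤˣ) : IsBddMeas (factor σ) :=
  ⟨by unfold factor; fun_prop, 1, fun x => (norm_factor σ x).le⟩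

/-- Multiplication by the Blaschke factor. -/
def mulB (σ : ℤˣ) : L2 →L[ℂ] L2 := mulL (factor σ) (isBddMeas_factor σ)

theorem mulB_ae (σ : ℤˣ) (f : L2) : mulB σ f =ᵐ[volume] fun x => factor σ x * f x :=
  mulL_ae _ _ f

theorem mulB_neg_mulB (σ : ℤˣ) (f : L2) : mulB (-σ) (mulB σ f) = f := by
  refine Lp.ext ?_
  filter_upwards [mulB_ae (-σ) (mulB σ f), mulB_ae σ f] with x h1 h2
  rw [h1, h2, ← mul_assoc, factor_neg_mul, one_mul]

theorem mulB_mulB_neg (σ : ℤˣ) (f : L2) : mulB σ (mulB (-σ) f) = f := by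
  simpa using mulB_neg_mulB (-σ) f

theorem inner_mulB (σ : ℤˣ) (f g : L2) : ⟪f, mulB σ g⟫ = ⟪mulB (-σ) f, g⟫ := by
  rw [L2.inner_def, L2.inner_def]
  refine integral_congr_ae ?_
  filter_upwards [mulB_ae σ g, mulB_ae (-σ) f] with x h1 h2
  rw [h1, h2, RCLike.inner_apply, RCLike.inner_apply, map_mul, conj_factor, neg_neg]
  ring

theorem inner_mulB_mulB (σ : ℤˣ) (f g : L2) : ⟪mulB σ f, mulB σ g⟫ = ⟪f, g⟫ := by
  rw [inner_mulB, mulB_neg_mulB]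

theorem norm_mulB (σ : ℤˣ) (f : L2) : ‖mulB σ f‖ = ‖f‖ := by
  rw [@norm_eq_sqrt_re_inner ℂ, @norm_eq_sqrt_re_inner ℂ _ _ _ _ f, inner_mulB_mulB]

theorem mulB_eq (σ : ℤˣ) (f : L2) :
    mulB σ f = f - (2 * sgn σ * Complex.I) • cauchy σ f := by
  refine Lp.ext ?_
  filter_upwards [mulB_ae σ f, cauchy_ae σ f,
    Lp.coeFn_sub f ((2 * sgn σ * Complex.I) • cauchy σ f),
    Lp.coeFn_smul (2 * sgn σ * Complex.I) (cauchy σ f)] with x h1 h2 h3 h4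
  rw [h1, h3, Pi.sub_apply, h4, Pi.smul_apply, h2, smul_eq_mul, factor]
  have := add_sgn_I_ne_zero σ x
  field_simp
  ring

theorem mulB_cauchyFun (σ : ℤˣ) : mulB σ (cauchyFun (-σ)) = cauchyFun σ := by
  refine Lp.ext ?_
  filter_upwards [mulB_ae σ (cauchyFun (-σ)), cauchyFun_ae σ, cauchyFun_ae (-σ)] with x h1 h2 h3
  rw [h1, h2, h3, factor, sgn_neg]
  have := add_sgn_I_ne_zero σ x
  have := sub_sgn_I_ne_zero σ x
  rw [Complex.ofReal_neg, neg_mul, ← sub_eq_add_neg]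
  field_simp

theorem mulB_mem_hardy {σ : ℤˣ} {f : L2} (hf : f ∈ hardy σ) : mulB σ f ∈ hardy σ := by
  rw [mulB_eq]
  exact sub_mem hf (Submodule.smul_mem _ _ (cauchy_mem_hardy hf))

theorem smul_cauchy_eq (σ : ℤˣ) (f : L2) :
    (sgn σ * Complex.I) • cauchy σ f = (1 / 2 : ℂ) • (f - mulB σ f) := by
  rw [mulB_eq, sub_sub_cancel, smul_smul]
  congr 1
  ring

/-- The second difference `(2 - B - B⁻¹) f`, multiplication by `4 / (1 + x ^ 2)`. -/
def secondDiff : L2 →L[ℂ] L2 := 2 - mulB 1 - mulB (-1)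

theorem secondDiff_apply (σ : ℤˣ) (f : L2) :
    secondDiff f = (2 : ℂ) • f - mulB σ f - mulB (-σ) f := by
  rcases Int.units_eq_one_or σ with rfl | rfl
  · simp [secondDiff, two_smul, ofNat_smul_eq_nsmul]
  · simp [secondDiff, two_smul, ofNat_smul_eq_nsmul]
    abel

theorem mulB_secondDiff (σ : ℤˣ) (f : L2) : mulB σ (secondDiff f) = secondDiff (mulB σ f) := by
  rw [secondDiff_apply σ, secondDiff_apply σ, map_sub, map_sub, map_smul, mulB_neg_mulB,
    mulB_mulB_neg]

/-- The Leibniz rule for B = 1 - 2σi/(x + σi). The added term is multiplication by 2/(1 + x²) =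
|B'|, which has the same sign on both Hardy spaces. -/
theorem isNabla_mulB {σ : ℤˣ} {f g : L2} (hf : f ∈ hardy σ) (h : IsNabla f g) :
    IsNabla (mulB σ f) (mulB σ (g + (1 / 2 : ℂ) • secondDiff f)) := by
  have h1 := h.sub ((isNabla_cauchy hf h).smul (2 * sgn σ * Complex.I))
  rw [mulB_eq]
  convert h1 using 1
  rw [smul_add, ← sub_sub, ← mulB_eq, map_add, sub_eq_add_neg]
  congr 1
  have h2 : (2 * sgn σ * Complex.I) • (sgn σ * Complex.I) • cauchy σ (cauchy σ f) =
      (2 : ℂ) • (sgn σ * Complex.I) • cauchy σ ((sgn σ * Complex.I) • cauchy σ f) := by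
    rw [map_smul, smul_smul, smul_smul, smul_smul]
    congr 1
    ring
  rw [h2, smul_cauchy_eq, smul_cauchy_eq, map_smul, map_smul, secondDiff_apply σ, map_sub, map_sub,
    map_sub, map_smul, mulB_mulB_neg]
  module

theorem mulB_pow_mem_hardy {σ : ℤˣ} {f : L2} (hf : f ∈ hardy σ) (n : ℕ) :
    (mulB σ ^ n) f ∈ hardy σ := by
  induction n with
  | zero => simpa using hf
  | succ n ih =>
    rw [pow_succ']
    exact mulB_mem_hardy ih

theorem isNabla_mulB_pow {σ : ℤˣ} {f g : L2} (hf : f ∈ hardy σ) (h : IsNabla f g) (n : ℕ) :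
    IsNabla ((mulB σ ^ n) f) ((mulB σ ^ n) (g + (n / 2 : ℂ) • secondDiff f)) := by
  induction n with
  | zero => simpa using h
  | succ n ih =>
    have h1 := isNabla_mulB (mulB_pow_mem_hardy hf n) ih
    have hc : ∀ k : ℕ, secondDiff ((mulB σ ^ k) f) = (mulB σ ^ k) (secondDiff f) := by
      intro k
      induction k with
      | zero => simp
      | succ k ihk =>
        rw [pow_succ', mul_apply_eq_comp, mul_apply_eq_comp,
          ← mulB_secondDiff, ihk]
    rw [pow_succ', mul_apply_eq_comp, mul_apply_eq_comp]
    convert h1 using 2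
    rw [hc, map_add, map_add, map_smul, map_smul]
    push_cast
    module

/-! ### The rational basis `e j = (x - i) ^ j / (x + i) ^ (j + 1)` -/

theorem factor_one_ne_zero (x : ℝ) : factor 1 x ≠ 0 := by
  rw [← norm_ne_zero_iff, norm_factor]
  exact one_ne_zero

/-- The function `(x - i) ^ j / (x + i) ^ (j + 1)`. -/
def ratFun (j : ℤ) (x : ℝ) : ℂ := factor 1 x ^ j * ((x : ℂ) + Complex.I)⁻¹

theorem measurable_ratFun (j : ℤ) : Measurable (ratFun j) := by
  have := (isBddMeas_factor 1).1
  unfold ratFun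
  fun_prop

theorem norm_ratFun_sq (j : ℤ) (x : ℝ) : ‖ratFun j x‖ ^ 2 = (1 + x ^ 2)⁻¹ := by
  rw [ratFun, norm_mul, norm_zpow, norm_factor, one_zpow, one_mul, norm_inv, inv_pow,
    norm_add_I_sq]

theorem memLp_ratFun (j : ℤ) : MemLp (ratFun j) 2 := by
  rw [memLp_two_iff_integrable_sq_norm (measurable_ratFun j).aestronglyMeasurable]
  simpa only [norm_ratFun_sq] using integrable_inv_one_add_sq

/-- The function `(x - i) ^ j / (x + i) ^ (j + 1)` as an element of `L²`. -/
def e (j : ℤ) : L2 := (memLp_ratFun j).toLp _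

theorem e_ae (j : ℤ) : e j =ᵐ[volume] ratFun j := MemLp.coeFn_toLp _

theorem mulB_one_e (j : ℤ) : mulB 1 (e j) = e (j + 1) := by
  refine Lp.ext ?_
  filter_upwards [mulB_ae 1 (e j), e_ae j, e_ae (j + 1)] with x h1 h2 h3
  rw [h1, h2, h3, ratFun, ratFun, zpow_add_one₀ (factor_one_ne_zero x)]
  ring

theorem mulB_neg_one_e (j : ℤ) : mulB (-1) (e j) = e (j - 1) := by
  have h := mulB_neg_mulB 1 (e (j - 1))
  rwa [mulB_one_e, sub_add_cancel] at h

theorem e_zero : e 0 = cauchyFun 1 := by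
  refine Lp.ext ?_
  filter_upwards [e_ae 0, cauchyFun_ae 1] with x h1 h2
  rw [h1, h2, ratFun]
  simp [sgn_one]

theorem e_neg_one : e (-1) = cauchyFun (-1) := by
  have h := mulB_neg_mulB 1 (cauchyFun (-1))
  rw [mulB_cauchyFun, ← e_zero, mulB_neg_one_e] at h
  simpa using h

theorem mulB_one_pow_e (n : ℕ) (j : ℤ) : (mulB 1 ^ n) (e j) = e (j + n) := by
  induction n with
  | zero => simp
  | succ n ih =>
    rw [pow_succ', mul_apply_eq_comp, ih, mulB_one_e]
    congr 1
    push_cast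
    ring

theorem mulB_neg_one_pow_e (n : ℕ) (j : ℤ) : (mulB (-1) ^ n) (e j) = e (j - n) := by
  induction n with
  | zero => simp
  | succ n ih =>
    rw [pow_succ', mul_apply_eq_comp, ih, mulB_neg_one_e]
    congr 1
    push_cast
    ring

theorem secondDiff_e (j : ℤ) : secondDiff (e j) = (2 : ℂ) • e j - e (j + 1) - e (j - 1) := by
  rw [secondDiff_apply 1, mulB_one_e, mulB_neg_one_e]

theorem e_mem_hardy_one {j : ℤ} (hj : 0 ≤ j) : e j ∈ hardy 1 := by
  obtain ⟨n, rfl⟩ := Int.eq_ofNat_of_zero_le hj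
  have h := mulB_pow_mem_hardy (cauchyFun_mem_hardy 1) n
  rwa [← e_zero, mulB_one_pow_e, zero_add] at h

theorem e_mem_hardy_neg_one {j : ℤ} (hj : j < 0) : e j ∈ hardy (-1) := by
  obtain ⟨n, hn⟩ := Int.eq_ofNat_of_zero_le (show 0 ≤ -1 - j by omega)
  have h := mulB_pow_mem_hardy (cauchyFun_mem_hardy (-1)) n
  rw [← e_neg_one, mulB_neg_one_pow_e] at h
  rwa [show j = -1 - n by omega]

theorem isNabla_e_of_nonneg {j : ℤ} (hj : 0 ≤ j) :
    IsNabla (e j) ((1 / 2 : ℂ) • (e j - e (j + 1)) + (j / 2 : ℂ) • secondDiff (e j)) := by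
  obtain ⟨n, rfl⟩ := Int.eq_ofNat_of_zero_le hj
  have h0 := isNabla_cauchyFun 1
  rw [smul_cauchy_eq, ← e_zero, mulB_one_e] at h0
  have h1 := isNabla_mulB_pow (e_zero ▸ cauchyFun_mem_hardy 1) h0 n
  simp only [secondDiff_e, map_add, map_sub, map_smul, mulB_one_pow_e] at h1 ⊢
  convert h1 using 3 <;> simp [add_comm, sub_eq_add_neg]

/-- The mirror image of the nonnegative case under j ↦ -1 - j, which exchanges the two Hardy spaces;
the induction starts from e_(-1) = 1/(x - i). -/
theorem isNabla_e_of_neg {j : ℤ} (hj : j < 0) :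
    IsNabla (e j) ((1 / 2 : ℂ) • (e j - e (j - 1)) + ((-1 - j) / 2 : ℂ) • secondDiff (e j)) := by
  obtain ⟨n, hn⟩ := Int.eq_ofNat_of_zero_le (show 0 ≤ -1 - j by omega)
  obtain rfl : j = -1 - n := by omega
  have h0 := isNabla_cauchyFun (-1)
  rw [smul_cauchy_eq, ← e_neg_one, mulB_neg_one_e] at h0
  have h1 := isNabla_mulB_pow (e_neg_one ▸ cauchyFun_mem_hardy (-1)) h0 n
  simp only [secondDiff_e, map_add, map_sub, map_smul, mulB_neg_one_pow_e] at h1 ⊢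
  have a1 : (-1 - 1 - n : ℤ) = -1 - n - 1 := by ring
  have a2 : (-1 + 1 - n : ℤ) = -1 - n + 1 := by ring
  have a3 : ((-1 - ((-1 - n : ℤ) : ℂ)) / 2 : ℂ) = (n : ℂ) / 2 := by
    push_cast
    ring
  rw [a1, a2] at h1
  rwa [a3]

/-! ### Orthogonality and the Hardy projections -/

theorem inner_eq_zero_of_mem_hardy {σ : ℤˣ} {f g : L2} (hf : f ∈ hardy σ)
    (hg : g ∈ hardy (-σ)) : ⟪f, g⟫ = 0 := by
  rw [← Lp.inner_fourier_eq, L2.inner_def]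
  refine integral_eq_zero_of_ae ?_
  filter_upwards [mem_hardy.1 hf, mem_hardy.1 hg, ae_ne_zero] with ξ h1 h2 h3
  rw [sgn_neg] at h2
  rcases lt_or_gt_of_ne (mul_ne_zero (sgn_ne_zero σ) h3) with h | h
  · simp [h1 h]
  · simp [h2 (by linarith)]

theorem inner_e_shift (i j : ℤ) (n : ℕ) : ⟪e (i + n), e (j + n)⟫ = ⟪e i, e j⟫ := by
  induction n with
  | zero => simp
  | succ n ih =>
    have h := inner_mulB_mulB 1 (e (i + n)) (e (j + n))
    rw [mulB_one_e, mulB_one_e, ih] at h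
    push_cast
    rw [← add_assoc, ← add_assoc, h]

/-- Multiplication by a power of B is unitary, so i may be moved to -1. Then the two functions have
opposite frequencies. -/
theorem inner_e_of_lt {i j : ℤ} (h : i < j) : ⟪e i, e j⟫ = 0 := by
  have h0 : ⟪e (-1), e (j - i - 1)⟫ = 0 := by
    have := inner_eq_zero_of_mem_hardy (σ := -1) (e_mem_hardy_neg_one (j := -1) (by norm_num))
      (by simpa using e_mem_hardy_one (j := j - i - 1) (by omega))
    exact this
  rcases le_or_gt 0 i with hi | hi
  · obtain ⟨n, hn⟩ := Int.eq_ofNat_of_zero_le (show 0 ≤ i + 1 by omega)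
    rw [← h0, ← inner_e_shift (-1) (j - i - 1) n]
    congr 2 <;> omega
  · obtain ⟨n, hn⟩ := Int.eq_ofNat_of_zero_le (show 0 ≤ -1 - i by omega)
    rw [← h0, ← inner_e_shift i j n]
    congr 2 <;> omega

theorem inner_e_self (i : ℤ) : ⟪e i, e i⟫ = Real.pi := by
  rw [L2.inner_def, ← integral_univ_inv_one_add_sq, ← integral_complex_ofReal]
  refine integral_congr_ae ?_
  filter_upwards [e_ae i] with x hx
  rw [hx, RCLike.inner_apply, ← norm_ratFun_sq i x, ← Complex.normSq_eq_norm_sq,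
    Complex.normSq_eq_conj_mul_self, mul_comm]

theorem inner_e (i j : ℤ) : ⟪e i, e j⟫ = if i = j then (Real.pi : ℂ) else 0 := by
  split_ifs with h
  · rw [h, inner_e_self]
  · rcases lt_or_gt_of_ne h with h' | h'
    · exact inner_e_of_lt h'
    · rw [← inner_conj_symm, inner_e_of_lt h', map_zero]

theorem isBddMeas_indicator (σ : ℤˣ) :
    IsBddMeas ({ξ : ℝ | 0 < sgn σ * ξ}.indicator fun _ => (1 : ℂ)) := by
  refine ⟨measurable_const.indicator (measurableSet_lt (by fun_prop) (by fun_prop)), 1,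
    fun x => ?_⟩
  rw [Set.indicator_apply]
  split_ifs <;> simp

/-- The projection onto the Hardy space. -/
def proj (σ : ℤˣ) : L2 →L[ℂ] L2 :=
  (Lp.fourierTransformₗᵢ ℝ ℂ).symm.toContinuousLinearEquiv.toContinuousLinearMap ∘L
    mulL _ (isBddMeas_indicator σ) ∘L
      (Lp.fourierTransformₗᵢ ℝ ℂ).toContinuousLinearEquiv.toContinuousLinearMap

theorem fourier_proj (σ : ℤˣ) (f : L2) : (𝓕 (proj σ f) : L2) =ᵐ[volume]
    fun ξ => {ξ : ℝ | 0 < sgn σ * ξ}.indicator (fun _ => (1 : ℂ)) ξ * (𝓕 f : L2) ξ := by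
  have h : (𝓕 (proj σ f) : L2) = mulL _ (isBddMeas_indicator σ) (𝓕 f) :=
    (Lp.fourierTransformₗᵢ ℝ ℂ).apply_symm_apply _
  rw [h]
  exact mulL_ae _ _ _

theorem eq_of_fourier_ae_eq {f g : L2} (h : (𝓕 f : L2) =ᵐ[volume] (𝓕 g : L2)) : f = g :=
  (Lp.fourierTransformₗᵢ ℝ ℂ).injective (Lp.ext h)

theorem proj_mem_hardy (σ : ℤˣ) (f : L2) : proj σ f ∈ hardy σ := by
  rw [mem_hardy]
  filter_upwards [fourier_proj σ f] with ξ h1 h2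
  rw [h1, Set.indicator_of_notMem (by simpa using h2.le), zero_mul]

theorem proj_eq_self {σ : ℤˣ} {f : L2} (hf : f ∈ hardy σ) : proj σ f = f := by
  refine eq_of_fourier_ae_eq ?_
  filter_upwards [fourier_proj σ f, mem_hardy.1 hf, ae_ne_zero] with ξ h1 h2 h3
  rw [h1]
  rcases lt_or_gt_of_ne (mul_ne_zero (sgn_ne_zero σ) h3) with h | h
  · rw [h2 h, mul_zero]
  · rw [Set.indicator_of_mem (by simpa using h), one_mul]

theorem proj_neg_eq_zero {σ : ℤˣ} {f : L2} (hf : f ∈ hardy σ) : proj (-σ) f = 0 := by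
  rw [← @inner_self_eq_zero ℂ, ← Lp.inner_fourier_eq, L2.inner_def]
  refine integral_eq_zero_of_ae ?_
  filter_upwards [fourier_proj (-σ) f, mem_hardy.1 hf] with ξ h1 h2
  rw [h1, sgn_neg]
  rcases lt_or_ge (sgn σ * ξ) 0 with h | h
  · simp [h2 h]
  · rw [Set.indicator_of_notMem (by simpa using h)]
    simp

theorem proj_add_proj (f : L2) : proj 1 f + proj (-1) f = f := by
  refine eq_of_fourier_ae_eq ?_
  have e1 : (𝓕 (proj 1 f + proj (-1) f) : L2) = 𝓕 (proj 1 f) + 𝓕 (proj (-1) f) :=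
    (Lp.fourierTransformₗᵢ ℝ ℂ).map_add _ _
  rw [e1]
  filter_upwards [fourier_proj 1 f, fourier_proj (-1) f, ae_ne_zero,
    Lp.coeFn_add (𝓕 (proj 1 f) : L2) (𝓕 (proj (-1) f))] with ξ h1 h2 h3 h4
  rw [h4, Pi.add_apply, h1, h2, ← add_mul]
  rcases lt_or_gt_of_ne h3 with h | h
  · simp [sgn_neg, sgn_one, h, h.le]
  · simp [sgn_neg, sgn_one, h, h.le]

theorem isNabla_proj (σ : ℤˣ) {f g : L2} (h : IsNabla f g) :
    IsNabla (proj σ f) (proj σ g) := by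
  unfold IsNabla
  filter_upwards [fourier_proj σ f, fourier_proj σ g, h] with ξ h1 h2 h3
  rw [h1, h2, h3, mul_left_comm]

/-! ### The isometry onto the orthogonal complement of the model space -/

theorem inner_mulB_pow (σ : ℤˣ) (n : ℕ) (f g : L2) :
    ⟪f, (mulB σ ^ n) g⟫ = ⟪(mulB (-σ) ^ n) f, g⟫ := by
  induction n generalizing f with
  | zero => simp
  | succ n ih =>
    rw [pow_succ', mul_apply_eq_comp, inner_mulB, ih, pow_succ, mul_apply_eq_comp]

theorem norm_mulB_pow (σ : ℤˣ) (n : ℕ) (f : L2) : ‖(mulB σ ^ n) f‖ = ‖f‖ := by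
  induction n with
  | zero => simp
  | succ n ih => rw [pow_succ', mul_apply_eq_comp, norm_mulB, ih]

theorem secondDiff_mulB_pow (σ : ℤˣ) (n : ℕ) (f : L2) :
    secondDiff ((mulB σ ^ n) f) = (mulB σ ^ n) (secondDiff f) := by
  induction n with
  | zero => simp
  | succ n ih => rw [pow_succ', mul_apply_eq_comp, mul_apply_eq_comp, ← mulB_secondDiff, ih]

/-- The shift: multiplication by `Q_m` on the Hardy space and by its conjugate on the
complementary Hardy space. -/
def shiftL (m : ℕ) : L2 →L[ℂ] L2 := (mulB 1 ^ m) ∘L proj 1 + (mulB (-1) ^ m) ∘L proj (-1)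

theorem shiftL_apply (m : ℕ) (f : L2) :
    shiftL m f = (mulB 1 ^ m) (proj 1 f) + (mulB (-1) ^ m) (proj (-1) f) := rfl

theorem norm_add_sq_of_mem_hardy {f g : L2} (hf : f ∈ hardy 1) (hg : g ∈ hardy (-1)) :
    ‖f + g‖ ^ 2 = ‖f‖ ^ 2 + ‖g‖ ^ 2 := by
  have h := norm_add_sq_eq_norm_sq_add_norm_sq_of_inner_eq_zero f g
    (inner_eq_zero_of_mem_hardy hf hg)
  simpa only [sq] using h

theorem norm_shiftL (m : ℕ) (f : L2) : ‖shiftL m f‖ = ‖f‖ := by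
  rw [← sq_eq_sq₀ (norm_nonneg _) (norm_nonneg _), shiftL_apply,
    norm_add_sq_of_mem_hardy (mulB_pow_mem_hardy (proj_mem_hardy _ _) _)
      (mulB_pow_mem_hardy (proj_mem_hardy _ _) _), norm_mulB_pow, norm_mulB_pow,
    ← norm_add_sq_of_mem_hardy (proj_mem_hardy _ _) (proj_mem_hardy _ _), proj_add_proj]

/-- `shiftL` as a linear isometry. -/
def shift (m : ℕ) : L2 →ₗᵢ[ℂ] L2 := ⟨(shiftL m).toLinearMap, norm_shiftL m⟩

theorem shift_apply (m : ℕ) (f : L2) :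
    shift m f = (mulB 1 ^ m) (proj 1 f) + (mulB (-1) ^ m) (proj (-1) f) := rfl

/-- The intertwining relation L₊W = W|∇|: by `mulPotential_eq` the additional term is the potential
applied to `shift m f`. -/
theorem isNabla_shift (m : ℕ) {f g : L2} (h : IsNabla f g) :
    IsNabla (shift m f) (shift m g + (m / 2 : ℂ) • secondDiff (shift m f)) := by
  have h1 := (isNabla_mulB_pow (proj_mem_hardy 1 f) (isNabla_proj 1 h) m).add
    (isNabla_mulB_pow (proj_mem_hardy (-1) f) (isNabla_proj (-1) h) m)
  rw [shift_apply, shift_apply]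
  convert h1 using 1
  simp only [map_add, map_smul, secondDiff_mulB_pow]
  module

/-- The model space spanned by `e j`, `-m ≤ j < m`. -/
def modelSpace (m : ℕ) : Submodule ℂ L2 := Submodule.span ℂ (e '' Set.Ico (-m : ℤ) m)

theorem e_mem_modelSpace {m : ℕ} {j : ℤ} (h1 : -m ≤ j) (h2 : j < m) : e j ∈ modelSpace m :=
  Submodule.subset_span ⟨j, ⟨h1, h2⟩, rfl⟩

theorem mulB_pow_cauchyFun_mem_modelSpace (σ : ℤˣ) {m n : ℕ} (h : n < m) :
    (mulB σ ^ n) (cauchyFun σ) ∈ modelSpace m := by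
  rcases Int.units_eq_one_or σ with rfl | rfl
  · rw [← e_zero, mulB_one_pow_e]
    exact e_mem_modelSpace (by omega) (by omega)
  · rw [← e_neg_one, mulB_neg_one_pow_e]
    exact e_mem_modelSpace (by omega) (by omega)

/-- One step of the Wold decomposition: g is B⁻¹f with its pole removed, and multiplying the removed
pole by B gives back 1/(x + σi). -/
theorem exists_eq_smul_add_mulB {σ : ℤˣ} {f : L2} (hf : f ∈ hardy σ) :
    ∃ (c : ℂ) (g : L2), g ∈ hardy σ ∧ f = c • cauchyFun σ + mulB σ g := by
  obtain ⟨c, hc⟩ := exists_cauchy_neg_sub_smul_mem_hardy hf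
  refine ⟨-(2 * sgn (-σ) * Complex.I) * c,
    f - (2 * sgn (-σ) * Complex.I) • (cauchy (-σ) f - c • cauchyFun (-σ)),
    sub_mem hf (Submodule.smul_mem _ _ hc), ?_⟩
  rw [smul_sub, ← sub_add, ← mulB_eq, map_add, mulB_mulB_neg, map_smul, map_smul, mulB_cauchyFun]
  module

theorem exists_eq_add_mulB_pow {σ : ℤˣ} {m n : ℕ} (hn : n ≤ m) {f : L2} (hf : f ∈ hardy σ) :
    ∃ k ∈ modelSpace m, ∃ g ∈ hardy σ, f = k + (mulB σ ^ n) g := by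
  induction n with
  | zero => exact ⟨0, zero_mem _, f, hf, by simp⟩
  | succ n ih =>
    obtain ⟨k, hk, g, hg, h⟩ := ih (by omega)
    obtain ⟨c, g', hg', h'⟩ := exists_eq_smul_add_mulB hg
    refine ⟨k + c • (mulB σ ^ n) (cauchyFun σ), add_mem hk (Submodule.smul_mem _ _
      (mulB_pow_cauchyFun_mem_modelSpace σ (by omega))), g', hg', ?_⟩
    rw [h, h', map_add, map_smul, pow_succ, mul_apply_eq_comp, add_assoc]

theorem exists_eq_add_shift (m : ℕ) (f : L2) : ∃ k ∈ modelSpace m, ∃ g, f = k + shift m g := by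
  obtain ⟨k, hk, g, hg, h⟩ := exists_eq_add_mulB_pow le_rfl (m := m) (proj_mem_hardy 1 f)
  obtain ⟨k', hk', g', hg', h'⟩ := exists_eq_add_mulB_pow le_rfl (m := m) (proj_mem_hardy (-1) f)
  refine ⟨k + k', add_mem hk hk', g + g', ?_⟩
  have h1 : proj 1 g' = 0 := by simpa using proj_neg_eq_zero hg'
  rw [shift_apply, map_add, map_add, proj_eq_self hg, h1, map_add, proj_eq_self hg', proj_neg_eq_zero hg,
    map_zero, add_zero, zero_add, ← proj_add_proj f, h, h']
  abel

/-- Moved to the other side of the inner product, the powers of B send e_j to e_(j-m) and e_(j+m).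
The bounds -m ≤ j < m put these in the Hardy spaces opposite to the two halves of g. -/
theorem inner_shift_eq_zero {m : ℕ} {k : L2} (hk : k ∈ modelSpace m) (g : L2) :
    ⟪k, shift m g⟫ = 0 := by
  induction hk using Submodule.span_induction with
  | mem x hx =>
    obtain ⟨j, ⟨h1, h2⟩, rfl⟩ := hx
    rw [shift_apply, inner_add_right, inner_mulB_pow, inner_mulB_pow, mulB_neg_one_pow_e, neg_neg,
      mulB_one_pow_e, inner_eq_zero_of_mem_hardy (e_mem_hardy_neg_one (by omega))
        (by simpa using proj_mem_hardy 1 g),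
      inner_eq_zero_of_mem_hardy (e_mem_hardy_one (by omega)) (proj_mem_hardy (-1) g), add_zero]
  | zero => simp
  | add x y _ _ hx hy => rw [inner_add_left, hx, hy, add_zero]
  | smul c x _ hx => rw [inner_smul_left, hx, mul_zero]

/-! ### The potential and the operator `R` in terms of the rational basis -/

theorem mulPotential_eq (m : ℕ) (f : L2) : mulPotential m f = (m / 2 : ℂ) • secondDiff f := by
  refine Lp.ext ?_
  rw [secondDiff_apply 1]
  have h0 : mulPotential m f =ᵐ[volume] fun x => (potential m x : ℂ) * f x :=
    MemLp.coeFn_toLp (memLp_potential_mul m f)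
  filter_upwards [h0, Lp.coeFn_smul (m / 2 : ℂ) ((2 : ℂ) • f - mulB 1 f - mulB (-1) f),
    Lp.coeFn_sub ((2 : ℂ) • f - mulB 1 f) (mulB (-1) f), Lp.coeFn_sub ((2 : ℂ) • f) (mulB 1 f),
    Lp.coeFn_smul (2 : ℂ) f, mulB_ae 1 f, mulB_ae (-1) f] with x h1 h2 h3 h4 h5 h6 h7
  rw [h1, h2, Pi.smul_apply, h3, Pi.sub_apply, h4, Pi.sub_apply, h5, Pi.smul_apply, h6, h7,
    smul_eq_mul, smul_eq_mul, potential, factor, factor, sgn_neg, sgn_one]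
  have e1 : (x : ℂ) + Complex.I ≠ 0 := by simpa [sgn_one] using add_sgn_I_ne_zero 1 x
  have e2 : (x : ℂ) - Complex.I ≠ 0 := by simpa [sgn_one] using sub_sgn_I_ne_zero 1 x
  have e3 : (1 + (x : ℂ) ^ 2) = ((x : ℂ) + Complex.I) * ((x : ℂ) - Complex.I) := by
    linear_combination Complex.I_sq
  push_cast
  rw [e3]
  simp only [one_mul, neg_mul, sub_neg_eq_add, ← sub_eq_add_neg]
  field_simp
  linear_combination (4 * (m : ℂ) * f x) * Complex.I_sq

theorem sum_Icc_neg_succ {M : Type*} [AddCommMonoid M] (n : ℕ) (f : ℤ → M) :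
    ∑ p ∈ Finset.Icc (-(n + 1 : ℕ) : ℤ) (n + 1 : ℕ), f p =
      f (n + 1) + (f (-(n + 1)) + ∑ p ∈ Finset.Icc (-n : ℤ) n, f p) := by
  have h : Finset.Icc (-(n + 1 : ℕ) : ℤ) (n + 1 : ℕ) =
      insert ((n : ℤ) + 1) (insert (-((n : ℤ) + 1)) (Finset.Icc (-n : ℤ) n)) := by
    ext p
    simp only [Finset.mem_Icc, Finset.mem_insert]
    omega
  rw [h, Finset.sum_insert, Finset.sum_insert]
  · simp
  · simp only [Finset.mem_Icc, Finset.mem_insert]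
    omega

theorem sum_Icc_zpow (z : ℂ) (n : ℕ) : ∑ p ∈ Finset.Icc (-n : ℤ) n, z ^ p =
    1 + ∑ j ∈ Finset.range n, z ^ (j + 1) + ∑ j ∈ Finset.range n, z⁻¹ ^ (j + 1) := by
  induction n with
  | zero => simp
  | succ n ih =>
    rw [sum_Icc_neg_succ, ih, Finset.sum_range_succ, Finset.sum_range_succ, zpow_neg, ← inv_zpow]
    norm_cast
    ring

/-- Passing from n to n + 1 raises every coefficient with |p| ≤ n by one, and the left side grows by
the same Dirichlet sum. -/
theorem fejer {z : ℂ} (hz : z ≠ 0) (n : ℕ) :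
    (∑ j ∈ Finset.range n, z ^ j) * ∑ j ∈ Finset.range n, z⁻¹ ^ j =
      ∑ p ∈ Finset.Icc (-n : ℤ) n, ((n - |p| : ℤ) : ℂ) * z ^ p := by
  induction n with
  | zero => simp
  | succ n ih =>
    have key : ∀ w : ℂ, w ≠ 0 → w ^ n * ∑ j ∈ Finset.range n, w⁻¹ ^ j =
        ∑ j ∈ Finset.range n, w ^ (j + 1) := by
      intro w hw
      rw [Finset.mul_sum, ← Finset.sum_range_reflect]
      refine Finset.sum_congr rfl fun j hj => ?_
      rw [Finset.mem_range] at hj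
      rw [inv_pow, ← div_eq_mul_inv, div_eq_iff (pow_ne_zero _ hw), ← pow_add]
      congr 1
      omega
    have k1 := key z hz
    have k2 := key z⁻¹ (inv_ne_zero hz)
    rw [inv_inv] at k2
    have h1 : ∑ p ∈ Finset.Icc (-(n + 1 : ℕ) : ℤ) (n + 1 : ℕ),
        (((n + 1 : ℕ) - |p| : ℤ) : ℂ) * z ^ p =
        ∑ p ∈ Finset.Icc (-n : ℤ) n, (((n - |p| : ℤ) : ℂ) * z ^ p + z ^ p) := by
      rw [sum_Icc_neg_succ]
      have a1 : |(n : ℤ) + 1| = n + 1 := abs_of_nonneg (by omega)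
      have a2 : |-((n : ℤ) + 1)| = n + 1 := by rw [abs_neg, a1]
      rw [a1, a2]
      push_cast
      rw [sub_self, zero_mul, zero_mul, zero_add, zero_add]
      refine Finset.sum_congr rfl fun p _ => ?_
      ring
    rw [h1, Finset.sum_add_distrib, ← ih, sum_Icc_zpow, Finset.sum_range_succ,
      Finset.sum_range_succ, ← k1, ← k2]
    have k3 : z ^ n * z⁻¹ ^ n = 1 := by rw [← mul_pow, mul_inv_cancel₀ hz, one_pow]
    linear_combination k3

/-- The difference of consecutive basis functions. -/
def d (p : ℤ) : L2 := e (p - 1) - e p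

theorem d_ae (p : ℤ) : d p =ᵐ[volume] fun x => 2 * Complex.I * factor 1 x ^ p / (1 + x ^ 2) := by
  filter_upwards [Lp.coeFn_sub (e (p - 1)) (e p), e_ae (p - 1), e_ae p] with x h1 h2 h3
  rw [d, h1, Pi.sub_apply, h2, h3, ratFun, ratFun, zpow_sub_one₀ (factor_one_ne_zero x)]
  have e1 : (x : ℂ) + Complex.I ≠ 0 := by simpa [sgn_one] using add_sgn_I_ne_zero 1 x
  have e2 : (x : ℂ) - Complex.I ≠ 0 := by simpa [sgn_one] using sub_sgn_I_ne_zero 1 x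
  have e3 : (1 + (x : ℂ) ^ 2) = ((x : ℂ) + Complex.I) * ((x : ℂ) - Complex.I) := by
    linear_combination Complex.I_sq
  have e4 : (factor 1 x)⁻¹ = ((x : ℂ) + Complex.I) / ((x : ℂ) - Complex.I) := by
    simp [factor, sgn_one]
  rw [e3, e4]
  field_simp
  ring

/-- With z = B(x) times the conjugate of B(y), the difference of the two values of B^m has modulus
|z^m - 1| = |z - 1| |1 + z + ... + z^(m-1)|. The first factor cancels |x - y|², and the square of
the second is the Fejér sum. On the diagonal the quotient is 0/0 = 0, so the identity is claimed
only off it. -/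
theorem kernelR_eq (m : ℕ) {x y : ℝ} (h : x ≠ y) : (kernelR m x y : ℂ) =
    ∑ p ∈ Finset.Icc (-m : ℤ) m, (1 / (2 * Real.pi) * ((m - |p| : ℤ) : ℂ)) *
      ((2 * Complex.I * factor 1 x ^ p / (1 + x ^ 2)) *
        (starRingEnd ℂ) (2 * Complex.I * factor 1 y ^ p / (1 + y ^ 2))) := by
  set z : ℂ := factor 1 x * factor (-1) y with hz
  have hz1 : ‖z‖ = 1 := by rw [hz, norm_mul, norm_factor, norm_factor, one_mul]
  have hz0 : z ≠ 0 := by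
    rw [← norm_ne_zero_iff, hz1]
    exact one_ne_zero
  have hinv : z⁻¹ = (starRingEnd ℂ) z := by
    rw [Complex.inv_def, Complex.normSq_eq_norm_sq, hz1]
    simp
  have hb : ∀ n, blaschke n x - blaschke n y = blaschke n y * (z ^ n - 1) := by
    intro n
    have h1 : ∀ t, blaschke n t = factor 1 t ^ n := by
      intro t
      simp [factor, blaschke, sgn_one]
    have h2 : factor 1 y ^ n * factor (-1) y ^ n = 1 := by
      rw [← mul_pow, mul_comm, factor_neg_mul, one_pow]
    rw [h1, h1, hz, mul_pow]
    linear_combination (-(factor 1 x ^ n)) * h2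
  have hnb : ∀ n, ‖blaschke n y‖ = 1 := fun n => by
    simp only [blaschke, norm_pow, norm_blaschke_base, one_pow]
  have h1 : ‖blaschke m x - blaschke m y‖ ^ 2 =
      4 * |x - y| ^ 2 / ((1 + x ^ 2) * (1 + y ^ 2)) * ‖∑ j ∈ Finset.range m, z ^ j‖ ^ 2 := by
    rw [← norm_blaschke_one_sub_sq, hb, hb, ← mul_geom_sum, norm_mul, norm_mul, norm_mul, hnb,
      hnb, pow_one]
    ring
  have h2 : ((‖∑ j ∈ Finset.range m, z ^ j‖ ^ 2 : ℝ) : ℂ) =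
      ∑ p ∈ Finset.Icc (-m : ℤ) m, ((m - |p| : ℤ) : ℂ) * z ^ p := by
    rw [← fejer hz0, ← Complex.normSq_eq_norm_sq, ← Complex.mul_conj, map_sum]
    simp only [map_pow, hinv]
  have hxy : |x - y| ≠ 0 := abs_ne_zero.2 (sub_ne_zero.2 h)
  have h3 : kernelR m x y = 1 / (2 * Real.pi) * (4 / ((1 + x ^ 2) * (1 + y ^ 2))) *
      ‖∑ j ∈ Finset.range m, z ^ j‖ ^ 2 := by
    rw [kernelR, norm_profile_sub, h1]
    field_simp
  rw [h3, Complex.ofReal_mul, h2, Finset.mul_sum]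
  refine Finset.sum_congr rfl fun p _ => ?_
  rw [hz, mul_zpow, ← conj_factor]
  generalize ((m - |p| : ℤ) : ℂ) = c
  simp only [map_div₀, map_mul, map_zpow₀, Complex.conj_I, map_add, map_pow, map_one,
    Complex.conj_ofReal, Complex.conj_ofNat]
  push_cast
  have a1 : (1 + (x : ℂ) ^ 2) ≠ 0 := by
    have : (1 + x ^ 2 : ℝ) ≠ 0 := by positivity
    exact_mod_cast this
  have a2 : (1 + (y : ℂ) ^ 2) ≠ 0 := by
    have : (1 + y ^ 2 : ℝ) ≠ 0 := by positivity
    exact_mod_cast this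
  have a3 : (Real.pi : ℂ) ≠ 0 := by exact_mod_cast Real.pi_ne_zero
  field_simp
  linear_combination (4 * c * factor 1 x ^ p *
    (starRingEnd ℂ) (factor 1 y) ^ p) * Complex.I_sq

theorem coeFn_finset_sum_smul {ι : Type*} (s : Finset ι) (c : ι → ℂ) (f : ι → L2) :
    (∑ i ∈ s, c i • f i : L2) =ᵐ[volume] fun x => ∑ i ∈ s, c i * f i x := by
  classical
  induction s using Finset.induction_on with
  | empty =>
    simp only [Finset.sum_empty]
    exact Lp.coeFn_zero ℂ 2 volume
  | insert i s hi ih =>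
    rw [Finset.sum_insert hi]
    filter_upwards [ih, Lp.coeFn_add (c i • f i) (∑ i ∈ s, c i • f i), Lp.coeFn_smul (c i) (f i)]
      with x h1 h2 h3
    rw [h2, Pi.add_apply, h1, h3, Pi.smul_apply, smul_eq_mul, Finset.sum_insert hi]

theorem integrable_conj_mul_and_inner_d (p : ℤ) (f : L2) :
    Integrable (fun y : ℝ =>
      (starRingEnd ℂ) (2 * Complex.I * factor 1 y ^ p / (1 + y ^ 2)) * f y) ∧
    ∫ y : ℝ, (starRingEnd ℂ) (2 * Complex.I * factor 1 y ^ p / (1 + y ^ 2)) * f y = ⟪d p, f⟫ := by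
  have h : (fun y => ⟪d p y, f y⟫) =ᵐ[volume] fun y : ℝ =>
      (starRingEnd ℂ) (2 * Complex.I * factor 1 y ^ p / (1 + y ^ 2)) * f y := by
    filter_upwards [d_ae p] with y hy
    rw [hy, RCLike.inner_apply, mul_comm]
  exact ⟨(L2.integrable_inner (d p) f).congr h, by rw [L2.inner_def, integral_congr_ae h]⟩

theorem opR_eq (m : ℕ) (f : L2) : opR m f =
    ∑ p ∈ Finset.Icc (-m : ℤ) m, (1 / (2 * Real.pi) * ((m - |p| : ℤ) : ℂ) * ⟪d p, f⟫) • d p := by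
  refine Lp.ext ?_
  have h0 : opR m f =ᵐ[volume] fun x => ∫ y, (kernelR m x y : ℂ) * f y :=
    MemLp.coeFn_toLp (memLp_integral_kernelR m f)
  filter_upwards [h0, coeFn_finset_sum_smul (Finset.Icc (-m : ℤ) m)
    (fun p => 1 / (2 * Real.pi) * ((m - |p| : ℤ) : ℂ) * ⟪d p, f⟫) d, ae_all_iff.2 d_ae]
    with x h1 h2 h3
  rw [h1, h2]
  have h4 : ∫ y, (kernelR m x y : ℂ) * f y = ∫ y : ℝ, ∑ p ∈ Finset.Icc (-m : ℤ) m,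
      (1 / (2 * Real.pi) * ((m - |p| : ℤ) : ℂ) * d p x) *
        ((starRingEnd ℂ) (2 * Complex.I * factor 1 y ^ p / (1 + y ^ 2)) * f y) := by
    refine integral_congr_ae ?_
    -- The diagonal, where the kernel formula is not available, is a null set for fixed x.
    have hne : ∀ᵐ y : ℝ, y ≠ x := by simp [ae_iff, measure_singleton]
    filter_upwards [hne] with y hy
    rw [kernelR_eq m hy.symm, Finset.sum_mul]
    refine Finset.sum_congr rfl fun p _ => ?_
    rw [h3]
    ring
  rw [h4, integral_finsetSum _ fun p _ => (integrable_conj_mul_and_inner_d p f).1.const_mul _]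
  refine Finset.sum_congr rfl fun p _ => ?_
  rw [integral_const_mul, (integrable_conj_mul_and_inner_d p f).2]
  ring

section Abstract

variable {H : Type*} [NormedAddCommGroup H] [InnerProductSpace ℂ H]

/-! ### Symmetric operators -/

theorem eq_zero_of_symm_of_im_ne_zero {T : H →ₗ.[ℂ] H} (hT : T.IsFormalAdjoint T) {z : ℂ}
    (hz : z.im ≠ 0) {f : T.domain} (h : T f = z • (f : H)) : (f : H) = 0 := by
  have h1 := hT f f
  rw [h, inner_smul_left, inner_smul_right] at h1
  have h2 : ((starRingEnd ℂ) z - z) * ⟪(f : H), f⟫ = 0 := by linear_combination h1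
  rcases mul_eq_zero.1 h2 with h3 | h3
  · exact absurd (Complex.conj_eq_iff_im.1 (sub_eq_zero.1 h3)) hz
  · exact inner_self_eq_zero.1 h3

/-- The basic criterion for self-adjointness, with density of the domain derived rather than
assumed. -/
theorem isSelfAdjoint_of_symm_of_surjective [CompleteSpace H] {T : H →ₗ.[ℂ] H}
    (hT : T.IsFormalAdjoint T)
    (h1 : ∀ h : H, ∃ f : T.domain, T f - Complex.I • (f : H) = h)
    (h2 : ∀ h : H, ∃ f : T.domain, T f + Complex.I • (f : H) = h) : IsSelfAdjoint T := by
  -- A vector orthogonal to the domain has the form Tf + if. Pairing it with f and using that ⟪f,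
  -- Tf⟫ is real forces f = 0.
  have hd : Dense (T.domain : Set H) := by
    rw [Submodule.dense_iff_topologicalClosure_eq_top, Submodule.topologicalClosure_eq_top_iff,
      Submodule.eq_bot_iff]
    intro y hy
    obtain ⟨f, rfl⟩ := h2 y
    have h3 := (Submodule.mem_orthogonal _ _).1 hy
    have h4 : (f : H) = 0 := by
      have e1 := h3 f f.2
      have e2 := hT f f
      rw [inner_add_right, inner_smul_right] at e1
      have e3 := inner_conj_symm (𝕜 := ℂ) (f : H) (T f)
      rw [e2] at e3
      have e4 : ⟪(f : H), f⟫ = Complex.I * ⟪(f : H), T f⟫ := by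
        linear_combination -Complex.I * e1 + ⟪(f : H), f⟫ * Complex.I_sq
      have e5 : (⟪(f : H), f⟫).re = 0 := by
        rw [e4]
        have := Complex.conj_eq_iff_im.1 e3
        simp [this]
      have e6 : (⟪(f : H), f⟫).im = 0 := @inner_self_im ℂ H _ _ _ (f : H)
      exact inner_self_eq_zero.1 (Complex.ext e5 e6)
    have h5 : f = 0 := Subtype.ext h4
    simp [h5]
  have hle : T ≤ T.adjoint := hT.le_adjoint hd
  rw [LinearPMap.isSelfAdjoint_def]
  refine (LinearPMap.eq_of_le_of_domain_eq hle (le_antisymm hle.1 fun y hy => ?_)).symm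
  obtain ⟨f, hf⟩ := h1 (T.adjoint ⟨y, hy⟩ - Complex.I • y)
  have h3 : ∀ x : T.domain, ⟪y - f, T x + Complex.I • (x : H)⟫ = 0 := by
    intro x
    have e1 := LinearPMap.adjoint_isFormalAdjoint hd ⟨y, hy⟩ x
    have e2 := hT f x
    have e3 := congrArg (fun v => ⟪v, (x : H)⟫) hf
    simp only [inner_sub_left, inner_smul_left, inner_add_right, inner_smul_right,
      Complex.conj_I] at e1 e2 e3 ⊢
    linear_combination -e1 + e2 - e3
  obtain ⟨x, hx⟩ := h2 (y - f)
  have h4 := h3 x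
  rw [hx, inner_self_eq_zero, sub_eq_zero] at h4
  rw [h4]
  exact f.2

/-! ### Operators that split into a finite-dimensional part and a shifted copy of `A` -/

/-- The symmetric operator `T` is the orthogonal sum of the endomorphism `M` of the finite
dimensional space `K` and of the conjugate of `A` by the isometry `W` onto the complement of `K`. -/
structure Splits (T A : H →ₗ.[ℂ] H) (K : Submodule ℂ H) (M : H →ₗ[ℂ] H) (W : H →ₗᵢ[ℂ] H) :
    Prop where
  symm : T.IsFormalAdjoint T
  finite : FiniteDimensional ℂ K
  apply_K : ∀ k ∈ K, ∃ h : k ∈ T.domain, T ⟨k, h⟩ = M k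
  map_K : ∀ k ∈ K, M k ∈ K
  apply_W : ∀ g : A.domain, ∃ h : W g ∈ T.domain, T ⟨W g, h⟩ = W (A g)
  orth : ∀ k ∈ K, ∀ g, ⟪k, W g⟫ = 0
  decomp : ∀ f, ∃ k ∈ K, ∃ g, f = k + W g

/-- The eigenvalues of `M` on `K`. -/
def eigenvaluesOn (K : Submodule ℂ H) (M : H →ₗ[ℂ] H) : Set ℂ :=
  {z | ∃ k ∈ K, k ≠ 0 ∧ M k = z • k}

namespace Splits

variable {T A : H →ₗ.[ℂ] H} {K : Submodule ℂ H} {M : H →ₗ[ℂ] H} {W : H →ₗᵢ[ℂ] H}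

theorem apply_add (hS : Splits T A K M W) {k : H} (hk : k ∈ K) (g : A.domain) :
    ∃ h : k + W g ∈ T.domain, T ⟨k + W g, h⟩ = M k + W (A g) := by
  obtain ⟨h1, h2⟩ := hS.apply_K k hk
  obtain ⟨h3, h4⟩ := hS.apply_W g
  refine ⟨add_mem h1 h3, ?_⟩
  rw [← h2, ← h4, ← LinearPMap.map_add]
  rfl

theorem unique (hS : Splits T A K M W) {k k' : H} (hk : k ∈ K) (hk' : k' ∈ K) {g g' : H}
    (h : k + W g = k' + W g') : k = k' ∧ g = g' := by
  have h1 : k - k' = W (g' - g) := by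
    rw [map_sub]
    rw [sub_eq_sub_iff_add_eq_add, h, add_comm]
  have h2 : k - k' = 0 := by
    have := hS.orth _ (sub_mem hk hk') (g' - g)
    rwa [← h1, inner_self_eq_zero] at this
  refine ⟨sub_eq_zero.1 h2, ?_⟩
  rw [h2, eq_comm, map_eq_zero_iff W W.injective] at h1
  exact (sub_eq_zero.1 h1).symm

theorem exists_sub_smul_eq (hS : Splits T A K M W) {z : ℂ} (hz : z ∉ eigenvaluesOn K M) :
    ∃ N : K ≃ₗ[ℂ] K, ∀ k : K, (N k : H) = M k - z • (k : H) := by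
  have := hS.finite
  have hmap : ∀ k ∈ K, (M - z • (LinearMap.id : H →ₗ[ℂ] H)) k ∈ K := fun k hk =>
    sub_mem (hS.map_K k hk) (Submodule.smul_mem _ _ hk)
  have hinj : Function.Injective ((M - z • (LinearMap.id : H →ₗ[ℂ] H)).restrict hmap) := by
    rw [injective_iff_map_eq_zero]
    intro k hk
    by_contra hne
    refine hz ⟨k, k.2, fun h => hne (Subtype.ext h), ?_⟩
    have := congrArg Subtype.val hk
    simpa [sub_eq_zero] using this
  exact ⟨LinearEquiv.ofInjectiveEndo _ hinj, fun k => rfl⟩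

theorem exists_preimage (hS : Splits T A K M W) {z : ℂ} (hz : z ∉ eigenvaluesOn K M)
    (hA : z ∈ resolventSet A) (h : H) :
    ∃ k ∈ K, ∃ g : A.domain, (M k + W (A g)) - z • (k + W g) = h := by
  obtain ⟨N, hN⟩ := hS.exists_sub_smul_eq hz
  obtain ⟨k, hk, g, rfl⟩ := hS.decomp h
  obtain ⟨B, hB, -⟩ := hA
  obtain ⟨h1, h2⟩ := hB g
  refine ⟨N.symm ⟨k, hk⟩, (N.symm ⟨k, hk⟩).2, ⟨B g, h1⟩, ?_⟩
  have h3 := hN (N.symm ⟨k, hk⟩)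
  rw [LinearEquiv.apply_symm_apply] at h3
  have h4 := congrArg W h2
  rw [map_sub, map_smul] at h4
  rw [smul_add, add_sub_add_comm, ← h3, h4]

theorem notMem_eigenvaluesOn (hS : Splits T A K M W) {z : ℂ} (hz : z.im ≠ 0) :
    z ∉ eigenvaluesOn K M := by
  rintro ⟨k, hk, hk0, h⟩
  obtain ⟨h1, h2⟩ := hS.apply_K k hk
  exact hk0 (eq_zero_of_symm_of_im_ne_zero hS.symm hz (f := ⟨k, h1⟩) (h2.trans h))

/-- `Splits` only gives that K and W(dom A) lie in the domain of T. Conversely, (T - i)u = (T - i)f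
can be solved with u in K + W(dom A), and T - i is injective by symmetry, so f = u. -/
theorem domain_decomp (hS : Splits T A K M W) (hA : Complex.I ∈ resolventSet A) (f : T.domain) :
    ∃ k ∈ K, ∃ g : A.domain, (f : H) = k + W g ∧ T f = M k + W (A g) := by
  obtain ⟨k, hk, g, h⟩ := hS.exists_preimage (hS.notMem_eigenvaluesOn (z := Complex.I) (by simp))
    hA (T f - Complex.I • (f : H))
  obtain ⟨h1, h2⟩ := hS.apply_add hk g
  have h3 : ((f - ⟨k + W g, h1⟩ : T.domain) : H) = 0 := by
    refine eq_zero_of_symm_of_im_ne_zero hS.symm (z := Complex.I) (by simp) ?_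
    rw [LinearPMap.map_sub, h2, Submodule.coe_sub, smul_sub]
    rw [sub_eq_sub_iff_sub_eq_sub]
    exact h.symm
  have h4 : f = ⟨k + W g, h1⟩ := sub_eq_zero.1 (Subtype.ext h3)
  exact ⟨k, hk, g, congrArg Subtype.val h4, by rw [h4, h2]⟩

theorem isSelfAdjoint [CompleteSpace H] (hS : Splits T A K M W)
    (hA : Complex.I ∈ resolventSet A) (hA' : -Complex.I ∈ resolventSet A) : IsSelfAdjoint T := by
  refine isSelfAdjoint_of_symm_of_surjective hS.symm (fun h => ?_) fun h => ?_
  · obtain ⟨k, hk, g, h1⟩ := hS.exists_preimage (hS.notMem_eigenvaluesOn (by simp)) hA h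
    obtain ⟨h2, h3⟩ := hS.apply_add hk g
    exact ⟨⟨_, h2⟩, by rw [h3, h1]⟩
  · obtain ⟨k, hk, g, h1⟩ := hS.exists_preimage (hS.notMem_eigenvaluesOn (by simp)) hA' h
    obtain ⟨h2, h3⟩ := hS.apply_add hk g
    exact ⟨⟨_, h2⟩, by rw [h3, ← h1, neg_smul, sub_neg_eq_add]⟩

/-- The component of an eigenvector in the range of W would be an eigenvector of A, hence vanishes.
-/
theorem mem_eigenspace_iff (hS : Splits T A K M W) (hA : Complex.I ∈ resolventSet A)
    (hev : ∀ z : ℂ, ∀ g : A.domain, A g = z • (g : H) → (g : H) = 0) (z : ℂ) (f : H) :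
    f ∈ eigenspace T z ↔ f ∈ K ∧ M f = z • f := by
  rw [HalfWave.mem_eigenspace_iff]
  constructor
  · rintro ⟨h, hf⟩
    obtain ⟨k, hk, g, h1, h2⟩ := hS.domain_decomp hA ⟨f, h⟩
    rw [hf] at h2
    change f = _ at h1
    rw [h1, smul_add, ← map_smul] at h2
    obtain ⟨h3, h4⟩ := hS.unique (Submodule.smul_mem _ _ hk) (hS.map_K k hk) h2
    rw [hev z g h4.symm, map_zero, add_zero] at h1
    rw [h1]
    exact ⟨hk, h3.symm⟩
  · rintro ⟨hk, h⟩
    obtain ⟨h1, h2⟩ := hS.apply_K f hk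
    exact ⟨h1, h2.trans h⟩

theorem pointSpectrum_eq (hS : Splits T A K M W) (hA : Complex.I ∈ resolventSet A)
    (hev : ∀ z : ℂ, ∀ g : A.domain, A g = z • (g : H) → (g : H) = 0) :
    pointSpectrum T = eigenvaluesOn K M := by
  ext z
  constructor
  · rintro ⟨f, hf0, hf⟩
    have h := (hS.mem_eigenspace_iff hA hev z f).1 ((HalfWave.mem_eigenspace_iff T z f).2 ⟨f.2, hf⟩)
    exact ⟨f, h.1, hf0, h.2⟩
  · rintro ⟨k, hk, hk0, h⟩
    obtain ⟨h1, h2⟩ := hS.apply_K k hk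
    exact ⟨⟨k, h1⟩, hk0, h2.trans h⟩

theorem finiteDimensional_eigenspace (hS : Splits T A K M W) (hA : Complex.I ∈ resolventSet A)
    (hev : ∀ z : ℂ, ∀ g : A.domain, A g = z • (g : H) → (g : H) = 0) (z : ℂ) :
    FiniteDimensional ℂ (eigenspace T z) := by
  have := hS.finite
  exact Submodule.finiteDimensional_of_le fun f hf => ((hS.mem_eigenspace_iff hA hev z f).1 hf).1

theorem adjoint_apply_add [CompleteSpace H] (hS : Splits T A K M W) {k : H} (hk : k ∈ K) (g : H) :
    W.toContinuousLinearMap.adjoint (k + W g) = g := by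
  refine ext_inner_right ℂ fun v => ?_
  rw [ContinuousLinearMap.adjoint_inner_left, inner_add_left]
  change ⟪k, W v⟫ + ⟪W g, W v⟫ = _
  rw [hS.orth k hk, W.inner_map_map, zero_add]

/-- A resolvent of T compresses to W*BW, a resolvent of A. Conversely, the inverse of M - z on K and
the resolvent of A are assembled into a block-diagonal operator. -/
theorem mem_resolventSet_iff [CompleteSpace H] (hS : Splits T A K M W)
    (hA : Complex.I ∈ resolventSet A) (z : ℂ) :
    z ∈ resolventSet T ↔ z ∉ eigenvaluesOn K M ∧ z ∈ resolventSet A := by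
  have := hS.finite
  constructor
  · rintro ⟨B, hB1, hB2⟩
    constructor
    · rintro ⟨k, hk, hk0, h⟩
      obtain ⟨h1, h2⟩ := hS.apply_K k hk
      have h3 := hB2 ⟨k, h1⟩
      rw [h2, h, sub_self, map_zero] at h3
      exact hk0 h3.symm
    · refine ⟨W.toContinuousLinearMap.adjoint ∘L B ∘L W.toContinuousLinearMap, fun g => ?_,
        fun g => ?_⟩
      · obtain ⟨h1, h2⟩ := hB1 (W g)
        obtain ⟨k, hk, g', h3, h4⟩ := hS.domain_decomp hA ⟨B (W g), h1⟩
        change B (W g) = _ at h3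
        have h5 : (W.toContinuousLinearMap.adjoint ∘L B ∘L W.toContinuousLinearMap) g = g' := by
          change W.toContinuousLinearMap.adjoint (B (W g)) = _
          rw [h3, hS.adjoint_apply_add hk]
        rw [h4, h3] at h2
        have h6 : (M k - z • k) + W (A g' - z • (g' : H)) = 0 + W g := by
          rw [← h2, map_sub, map_smul]
          module
        have h7 := (hS.unique (sub_mem (hS.map_K k hk) (Submodule.smul_mem _ _ hk)) (zero_mem _)
          h6).2
        refine ⟨by rw [h5]; exact g'.2, ?_⟩
        have h8 : A ⟨_, h5 ▸ g'.2⟩ = A g' := congrArg A (Subtype.ext h5)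
        rw [h8]
        refine Eq.trans ?_ h7
        rw [h5]
      · obtain ⟨h1, h2⟩ := hS.apply_W g
        change W.toContinuousLinearMap.adjoint (B (W (A g - z • (g : H)))) = g
        have h3 := hB2 ⟨W g, h1⟩
        rw [h2] at h3
        rw [map_sub, map_smul, h3]
        simpa using hS.adjoint_apply_add (zero_mem K) (g : H)
  · rintro ⟨hz, C, hC1, hC2⟩
    obtain ⟨N, hN⟩ := hS.exists_sub_smul_eq hz
    have hP : ∀ k (hk : k ∈ K) g, K.orthogonalProjectionOnto (k + W g) = ⟨k, hk⟩ := by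
      intro k hk g
      refine Subtype.ext ?_
      refine (Submodule.eq_starProjection_of_mem_of_inner_eq_zero hk fun w hw => ?_)
      rw [add_sub_cancel_left, ← inner_conj_symm, hS.orth w hw, map_zero]
    set B : H →L[ℂ] H := K.subtypeL ∘L N.symm.toContinuousLinearEquiv.toContinuousLinearMap ∘L
      K.orthogonalProjectionOnto +
      W.toContinuousLinearMap ∘L C ∘L W.toContinuousLinearMap.adjoint with hBdef
    have hB : ∀ k (hk : k ∈ K) g, B (k + W g) = (N.symm ⟨k, hk⟩ : H) + W (C g) := by
      intro k hk g
      change ((N.symm (K.orthogonalProjectionOnto (k + W g)) : K) : H) +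
        W (C (W.toContinuousLinearMap.adjoint (k + W g))) = _
      rw [hP k hk, hS.adjoint_apply_add hk]
    refine ⟨B, fun f => ?_, fun f => ?_⟩
    · obtain ⟨k, hk, g, rfl⟩ := hS.decomp f
      obtain ⟨h1, h2⟩ := hC1 g
      obtain ⟨h3, h4⟩ := hS.apply_add (N.symm ⟨k, hk⟩).2 ⟨C g, h1⟩
      have h5 := hB k hk g
      refine ⟨by rw [h5]; exact h3, ?_⟩
      have h6 := hN (N.symm ⟨k, hk⟩)
      rw [LinearEquiv.apply_symm_apply] at h6
      have h7 := congrArg W h2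
      rw [map_sub, map_smul] at h7
      have h8 : T ⟨B (k + W g), by rw [h5]; exact h3⟩ = T ⟨_, h3⟩ := congrArg T (Subtype.ext h5)
      rw [h8, h4, h5, smul_add, add_sub_add_comm, ← h6, h7]
    · obtain ⟨k, hk, g, h1, h2⟩ := hS.domain_decomp hA f
      have h3 : T f - z • (f : H) = (N ⟨k, hk⟩ : H) + W (A g - z • (g : H)) := by
        rw [h1, h2, hN, map_sub, map_smul]
        module
      rw [h3, hB _ (N ⟨k, hk⟩).2, hC2, h1]
      simp

theorem essentialSpectrum_eq [CompleteSpace H] (hS : Splits T A K M W)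
    (hev : ∀ z : ℂ, ∀ g : A.domain, A g = z • (g : H) → (g : H) = 0)
    (hA : spectrum A = (fun t : ℝ => (t : ℂ)) '' Set.Ici 0)
    (hfin : (eigenvaluesOn K M).Finite) :
    essentialSpectrum T = (fun t : ℝ => (t : ℂ)) '' Set.Ici 0 := by
  have hI : Complex.I ∈ resolventSet A := by
    have : Complex.I ∉ spectrum A := by
      rw [hA]
      rintro ⟨t, -, ht⟩
      have := congrArg Complex.im ht
      simp at this
    rwa [spectrum, Set.notMem_compl_iff] at this
  have hsp : spectrum T = eigenvaluesOn K M ∪ (fun t : ℝ => (t : ℂ)) '' Set.Ici 0 := by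
    rw [← hA]
    ext z
    rw [spectrum, Set.mem_compl_iff, hS.mem_resolventSet_iff hI, not_and_or, not_not,
      Set.mem_union, spectrum, Set.mem_compl_iff]
  ext z
  constructor
  · rintro ⟨h1, h2⟩
    by_contra h3
    refine h2 ⟨h1, ?_, ?_, hS.finiteDimensional_eigenspace hI hev z⟩
    · have hcl : IsClosed ((eigenvaluesOn K M \ {z}) ∪ (fun t : ℝ => (t : ℂ)) '' Set.Ici 0) :=
        (hfin.subset Set.sdiff_subset).isClosed.union
          (Complex.isometry_ofReal.isClosedEmbedding.isClosedMap _ isClosed_Ici)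
      have hz : z ∈ ((eigenvaluesOn K M \ {z}) ∪ (fun t : ℝ => (t : ℂ)) '' Set.Ici 0)ᶜ := by
        rintro (h | h)
        · exact h.2 rfl
        · exact h3 h
      obtain ⟨ε, hε, hb⟩ := Metric.isOpen_iff.1 hcl.isOpen_compl z hz
      refine ⟨ε, hε, fun w hw hd => ?_⟩
      by_contra hne
      refine hb hd ?_
      rw [hsp] at hw
      exact hw.imp (fun h => ⟨h, hne⟩) id
    · rw [hS.pointSpectrum_eq hI hev]
      rw [hsp] at h1
      exact h1.resolve_right h3
  · rintro ⟨t, ht, rfl⟩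
    refine ⟨?_, ?_⟩
    · rw [hsp]
      exact Or.inr ⟨t, ht, rfl⟩
    · rintro ⟨-, ⟨ε, hε, h⟩, -⟩
      -- No point of the half-line is isolated, its endpoint included, so the eigenvalue 0 does not
      -- leave the essential spectrum.
      have h1 := h ((t + ε / 2 : ℝ) : ℂ) (by
        rw [hsp]
        exact Or.inr ⟨_, by simp only [Set.mem_Ici] at ht ⊢; linarith, rfl⟩) (by
        rw [Complex.dist_eq, ← Complex.ofReal_sub, Complex.norm_real, Real.norm_eq_abs,
          add_sub_cancel_left, abs_of_pos (by linarith)]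
        linarith)
      have h2 := Complex.ofReal_injective h1
      linarith

end Splits

end Abstract

/-! ### The spectrum of `|∇|` -/

theorem fourier_sub_smul (f g : L2) (z : ℂ) :
    (𝓕 (g - z • f) : L2) =ᵐ[volume] fun ξ => (𝓕 g : L2) ξ - z * (𝓕 f : L2) ξ := by
  have h : (𝓕 (g - z • f) : L2) = 𝓕 g - z • 𝓕 f := by
    have h1 := (Lp.fourierTransformₗᵢ ℝ ℂ).map_sub g (z • f)
    rw [(Lp.fourierTransformₗᵢ ℝ ℂ).map_smul] at h1
    exact h1
  rw [h]
  filter_upwards [Lp.coeFn_sub (𝓕 g : L2) (z • 𝓕 f : L2), Lp.coeFn_smul z (𝓕 f : L2)]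
    with ξ h1 h2
  rw [h1, Pi.sub_apply, h2, Pi.smul_apply, smul_eq_mul]

theorem isNabla_absNabla (f : absNabla.domain) : IsNabla f (absNabla f) := by
  have h : (𝓕 (absNabla f) : L2) = (memLp_absSymbol_mul f).toLp _ :=
    (Lp.fourierTransformₗᵢ ℝ ℂ).apply_symm_apply _
  unfold IsNabla
  rw [h]
  exact MemLp.coeFn_toLp _

theorem IsNabla.unique {f g g' : L2} (h : IsNabla f g) (h' : IsNabla f g') : g = g' :=
  eq_of_fourier_ae_eq (h.trans h'.symm)

theorem IsNabla.exists_apply {f g : L2} (h : IsNabla f g) :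
    ∃ h : f ∈ absNabla.domain, absNabla ⟨f, h⟩ = g := by
  have h1 : f ∈ absNabla.domain := (Lp.memLp (𝓕 g : L2)).ae_eq h
  exact ⟨h1, (isNabla_absNabla ⟨f, h1⟩).unique h⟩

theorem absNabla_symm : absNabla.IsFormalAdjoint absNabla := by
  intro f g
  rw [← Lp.inner_fourier_eq, ← Lp.inner_fourier_eq (f : L2), L2.inner_def, L2.inner_def]
  refine integral_congr_ae ?_
  filter_upwards [isNabla_absNabla f, isNabla_absNabla g] with ξ h1 h2
  rw [h1, h2, RCLike.inner_apply, RCLike.inner_apply, map_mul, absSymbol, Complex.conj_ofReal]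
  ring

theorem absSymbol_ae_ne (z : ℂ) : ∀ᵐ ξ : ℝ, absSymbol ξ ≠ z := by
  have h : {ξ : ℝ | absSymbol ξ = z} ⊆ {z.re / (2 * Real.pi), -(z.re / (2 * Real.pi))} := by
    intro ξ hξ
    have h1 : 2 * Real.pi * |ξ| = z.re := by
      rw [← Complex.ofReal_re (2 * Real.pi * |ξ|)]
      exact congrArg Complex.re hξ
    have h2 : |ξ| = z.re / (2 * Real.pi) := by
      rw [← h1]
      field_simp
    rw [← h2]
    rcases abs_choice ξ with h | h
    · left
      exact h.symm
    · right
      rw [Set.mem_singleton_iff, h, neg_neg]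
  rw [ae_iff]
  simp only [not_not]
  exact measure_mono_null h (Set.Finite.measure_zero (by simp) _)

/-- The Fourier transform of an eigenfunction lives on a level set of |ξ|, which has at most two
points. -/
theorem absNabla_no_eigenvalue (z : ℂ) (g : absNabla.domain) (h : absNabla g = z • (g : L2)) :
    (g : L2) = 0 := by
  have e0 : (𝓕 (0 : L2) : L2) = 0 := (Lp.fourierTransformₗᵢ ℝ ℂ).map_zero
  have h1 := fourier_sub_smul (g : L2) (absNabla g) z
  rw [h, sub_self, e0] at h1
  refine eq_of_fourier_ae_eq ?_
  rw [e0]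
  have h2 := isNabla_absNabla g
  rw [h] at h2
  filter_upwards [h1, h2, Lp.coeFn_zero ℂ 2 (volume : Measure ℝ), absSymbol_ae_ne z]
    with ξ h3 h4 h5 h6
  rw [h5, Pi.zero_apply, h4, ← sub_mul] at h3
  rw [h5, Pi.zero_apply]
  exact (mul_eq_zero.1 h3.symm).resolve_left (sub_ne_zero.2 h6)

theorem mem_resolventSet_absNabla {z : ℂ} (hz : z ∉ (fun t : ℝ => (t : ℂ)) '' Set.Ici 0) :
    z ∈ resolventSet absNabla := by
  have hcl : IsClosed ((fun t : ℝ => (t : ℂ)) '' Set.Ici 0) :=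
    Complex.isometry_ofReal.isClosedEmbedding.isClosedMap _ isClosed_Ici
  obtain ⟨δ, hδ, hb⟩ := Metric.isOpen_iff.1 hcl.isOpen_compl z hz
  have hd : ∀ ξ, δ ≤ ‖absSymbol ξ - z‖ := by
    intro ξ
    by_contra hlt
    rw [not_le, ← dist_eq_norm] at hlt
    exact hb hlt ⟨_, by simp only [Set.mem_Ici]; positivity, rfl⟩
  have hne : ∀ ξ, absSymbol ξ - z ≠ 0 := fun ξ => norm_pos_iff.1 (hδ.trans_le (hd ξ))
  have hr : IsBddMeas fun ξ => (absSymbol ξ - z)⁻¹ := by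
    refine ⟨by unfold absSymbol; fun_prop, δ⁻¹, fun ξ => ?_⟩
    rw [norm_inv]
    exact inv_anti₀ hδ (hd ξ)
  set B : L2 →L[ℂ] L2 :=
    (Lp.fourierTransformₗᵢ ℝ ℂ).symm.toContinuousLinearEquiv.toContinuousLinearMap ∘L
      mulL _ hr ∘L (Lp.fourierTransformₗᵢ ℝ ℂ).toContinuousLinearEquiv.toContinuousLinearMap
      with hBdef
  have hB : ∀ g, (𝓕 (B g) : L2) =ᵐ[volume] fun ξ => (absSymbol ξ - z)⁻¹ * (𝓕 g : L2) ξ := by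
    intro g
    have h : (𝓕 (B g) : L2) = mulL _ hr (𝓕 g) := (Lp.fourierTransformₗᵢ ℝ ℂ).apply_symm_apply _
    rw [h]
    exact mulL_ae _ _ _
  refine ⟨B, fun g => ?_, fun f => ?_⟩
  · have h1 : IsNabla (B g) (g - (-z) • B g) := by
      unfold IsNabla
      filter_upwards [hB g, fourier_sub_smul (B g) g (-z)] with ξ h2 h3
      rw [h3, h2]
      have := hne ξ
      field_simp
      ring
    obtain ⟨h2, h3⟩ := h1.exists_apply
    refine ⟨h2, ?_⟩
    rw [h3]
    module
  · refine eq_of_fourier_ae_eq ?_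
    filter_upwards [hB (absNabla f - z • (f : L2)), fourier_sub_smul (f : L2) (absNabla f) z,
      isNabla_absNabla f] with ξ h1 h2 h3
    rw [h1, h2, h3, ← sub_mul, inv_mul_cancel_left₀ (hne ξ)]

/-- A wave packet with frequencies in a short interval just above t/(2π) is an approximate
eigenvector, which contradicts boundedness of the inverse. -/
theorem notMem_resolventSet_absNabla {t : ℝ} (ht : 0 ≤ t) :
    (t : ℂ) ∉ resolventSet absNabla := by
  rintro ⟨B, -, hB⟩
  have hpi := Real.pi_pos
  set a := t / (2 * Real.pi) with ha
  have ha0 : 0 ≤ a := by positivity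
  -- Chosen so that 2πδ‖B‖ < 1; then ‖f‖ ≤ ‖B‖ · 2πδ‖f‖ is impossible for f ≠ 0.
  set δ : ℝ := 1 / (2 * Real.pi * (‖B‖ + 1)) with hδ
  have hδ0 : 0 < δ := by positivity
  set φ : L2 := indicatorConstLp 2 (measurableSet_Ioo (a := a) (b := a + δ)) (by simp) (1 : ℂ)
  have hφ : φ =ᵐ[volume] (Set.Ioo a (a + δ)).indicator fun _ => (1 : ℂ) := indicatorConstLp_coeFn
  set f : L2 := 𝓕⁻ φ with hf
  have hfφ : (𝓕 f : L2) = φ := (Lp.fourierTransformₗᵢ ℝ ℂ).apply_symm_apply _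
  have hφ0 : 0 < ‖φ‖ := by
    rw [norm_indicatorConstLp (by norm_num) (by norm_num)]
    simp only [norm_one, one_mul]
    refine Real.rpow_pos_of_pos ?_ _
    rw [Real.volume_real_Ioo]
    simp [hδ0]
  have hfn : ‖f‖ = ‖φ‖ := by rw [← hfφ, Lp.norm_fourier_eq]
  have hmem : MemLp (fun ξ => absSymbol ξ * (𝓕 f : L2) ξ) 2 := by
    rw [hfφ]
    refine MemLp.of_le_mul (c := 2 * Real.pi * (a + δ)) (Lp.memLp φ)
      ((by unfold absSymbol; fun_prop : Measurable absSymbol).aestronglyMeasurable.mul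
        (Lp.memLp φ).aestronglyMeasurable) ?_
    filter_upwards [hφ] with ξ h1
    rw [h1, Set.indicator_apply]
    split_ifs with h
    · rw [norm_mul, absSymbol, Complex.norm_real, Real.norm_of_nonneg (by positivity),
        abs_of_nonneg (ha0.trans h.1.le)]
      gcongr
      exact h.2.le
    · simp
  set F : absNabla.domain := ⟨f, hmem⟩
  have hN := isNabla_absNabla F
  have hle : ‖absNabla F - (t : ℂ) • f‖ ≤ 2 * Real.pi * δ * ‖f‖ := by
    rw [← Lp.norm_fourier_eq, hfn]
    refine Lp.norm_le_mul_norm_of_ae_le_mul ?_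
    filter_upwards [fourier_sub_smul f (absNabla F) t, hN, hφ] with ξ h1 h2 h3
    rw [h1, h2]
    change ‖absSymbol ξ * (𝓕 f : L2) ξ - _‖ ≤ _
    rw [hfφ, ← sub_mul, norm_mul, h3, Set.indicator_apply]
    split_ifs with h
    · gcongr
      rw [absSymbol, ← Complex.ofReal_sub, Complex.norm_real, Real.norm_eq_abs,
        abs_of_nonneg (ha0.trans h.1.le)]
      have h4 : t = 2 * Real.pi * a := by
        rw [ha]
        field_simp
      rw [h4, ← mul_sub, abs_of_nonneg (mul_nonneg (by positivity) (by linarith [h.1]))]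
      gcongr
      linarith [h.2]
    · simp
  have h1 : ‖f‖ ≤ ‖B‖ * (2 * Real.pi * δ * ‖f‖) := by
    calc ‖f‖ = ‖B (absNabla F - (t : ℂ) • f)‖ := by rw [hB F]
      _ ≤ ‖B‖ * ‖absNabla F - (t : ℂ) • f‖ := B.le_opNorm _
      _ ≤ _ := by gcongr
  have h2 : 2 * Real.pi * δ * (‖B‖ + 1) = 1 := by
    rw [hδ]
    field_simp
  have h3 : 0 < ‖f‖ := hfn ▸ hφ0
  have h4 : 0 < 2 * Real.pi * δ * ‖f‖ := by positivity
  have h5 : 2 * Real.pi * δ * ‖f‖ * (‖B‖ + 1) = ‖f‖ := by linear_combination ‖f‖ * h2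
  nlinarith

theorem spectrum_absNabla : spectrum absNabla = (fun t : ℝ => (t : ℂ)) '' Set.Ici 0 := by
  ext z
  rw [spectrum, Set.mem_compl_iff]
  constructor
  · intro h
    by_contra h'
    exact h (mem_resolventSet_absNabla h')
  · rintro ⟨t, ht, rfl⟩
    exact notMem_resolventSet_absNabla ht

theorem mem_resolventSet_absNabla_of_im_ne_zero {z : ℂ} (hz : z.im ≠ 0) :
    z ∈ resolventSet absNabla := by
  refine mem_resolventSet_absNabla ?_
  rintro ⟨t, -, rfl⟩
  exact hz (Complex.ofReal_im t)

/-! ### The finite-rank operator `R` -/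

theorem inner_d_e (p j : ℤ) :
    ⟪d p, e j⟫ = (if p = j + 1 then (Real.pi : ℂ) else 0) - if p = j then (Real.pi : ℂ) else 0 := by
  rw [d, inner_sub_left, inner_e, inner_e]
  congr 2
  exact propext (by omega)

/-- The weight m - |p| vanishes at p = ±m, so those two directions, which are not in the model
space, do not contribute. -/
theorem opR_eq_zero {m : ℕ} {f : L2} (h : ∀ p : ℤ, |p| < m → ⟪d p, f⟫ = 0) : opR m f = 0 := by
  rw [opR_eq]
  refine Finset.sum_eq_zero fun p hp => ?_
  rw [Finset.mem_Icc] at hp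
  rcases (abs_le.2 hp).lt_or_eq with h1 | h1
  · rw [h p h1, mul_zero, zero_smul]
  · rw [h1]
    simp

theorem d_mem_modelSpace {m : ℕ} {p : ℤ} (h : |p| < m) : d p ∈ modelSpace m := by
  rw [abs_lt] at h
  exact sub_mem (e_mem_modelSpace (by omega) (by omega)) (e_mem_modelSpace (by omega) (by omega))

theorem opR_mem_modelSpace (m : ℕ) (f : L2) : opR m f ∈ modelSpace m := by
  rw [opR_eq]
  refine sum_mem fun p hp => ?_
  rw [Finset.mem_Icc] at hp
  rcases (abs_le.2 hp).lt_or_eq with h1 | h1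
  · exact Submodule.smul_mem _ _ (d_mem_modelSpace h1)
  · rw [h1]
    simp

theorem opR_shift (m : ℕ) (g : L2) : opR m (shift m g) = 0 :=
  opR_eq_zero fun _ h => inner_shift_eq_zero (d_mem_modelSpace h) g

theorem opR_symm (m : ℕ) (f g : L2) : ⟪opR m f, g⟫ = ⟪f, opR m g⟫ := by
  rw [opR_eq, opR_eq, sum_inner, inner_sum]
  refine Finset.sum_congr rfl fun p _ => ?_
  rw [inner_smul_left, inner_smul_right, map_mul, inner_conj_symm]
  simp only [map_mul, map_div₀, map_one, Complex.conj_ofReal, Complex.conj_ofNat, map_intCast]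
  ring

theorem re_inner_opR_nonneg (m : ℕ) (f : L2) : 0 ≤ (⟪f, opR m f⟫).re := by
  rw [opR_eq, inner_sum, Complex.re_sum]
  refine Finset.sum_nonneg fun p hp => ?_
  rw [Finset.mem_Icc, ← abs_le] at hp
  have h : ⟪f, (1 / (2 * Real.pi) * ((m - |p| : ℤ) : ℂ) * ⟪d p, f⟫) • d p⟫ =
      ((1 / (2 * Real.pi) * ((m - |p| : ℤ) : ℝ) * ‖⟪d p, f⟫‖ ^ 2 : ℝ) : ℂ) := by
    rw [inner_smul_right, mul_assoc, ← inner_conj_symm f, Complex.mul_conj,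
      Complex.normSq_eq_norm_sq]
    generalize (m - |p| : ℤ) = c
    push_cast
    ring
  rw [h, Complex.ofReal_re]
  have h1 : (0 : ℝ) ≤ ((m - |p| : ℤ) : ℝ) := by exact_mod_cast sub_nonneg.2 hp
  positivity

theorem opR_e {m : ℕ} {j : ℤ} (h1 : -m ≤ j) (h2 : j < m) : opR m (e j) =
    (((m - |j + 1| : ℤ) : ℂ) / 2) • d (j + 1) - (((m - |j| : ℤ) : ℂ) / 2) • d j := by
  have hpi : (Real.pi : ℂ) ≠ 0 := by exact_mod_cast Real.pi_ne_zero
  rw [opR_eq]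
  have h : ∀ p ∈ Finset.Icc (-m : ℤ) m,
      (1 / (2 * Real.pi) * ((m - |p| : ℤ) : ℂ) * ⟪d p, e j⟫) • d p =
      (if p = j + 1 then (((m - |p| : ℤ) : ℂ) / 2) • d p else 0) -
        if p = j then (((m - |p| : ℤ) : ℂ) / 2) • d p else 0 := by
    intro p _
    have h3 : ∀ c : ℂ, 1 / (2 * Real.pi) * c * Real.pi = c / 2 := fun c => by field_simp
    rw [inner_d_e, mul_sub, sub_smul]
    congr 1
    · split_ifs
      · rw [h3]
      · simp
    · split_ifs
      · rw [h3]
      · simp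
  rw [Finset.sum_congr rfl h, Finset.sum_sub_distrib, Finset.sum_ite_eq', Finset.sum_ite_eq',
    if_pos (by rw [Finset.mem_Icc]; omega), if_pos (by rw [Finset.mem_Icc]; omega)]

/-- This says L₋ = 0 on the model space. Subtracting R from the potential cancels m and leaves |j +
1|/2 (e_j - e_(j+1)) + |j|/2 (e_j - e_(j-1)), which is `|∇|` applied to e_j for either sign of j. -/
theorem isNabla_of_mem_modelSpace {m : ℕ} {k : L2} (hk : k ∈ modelSpace m) :
    IsNabla k (mulPotential m k - opR m k) := by
  induction hk using Submodule.span_induction with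
  | mem x hx =>
    obtain ⟨j, ⟨h1, h2⟩, rfl⟩ := hx
    rw [opR_e h1 h2, mulPotential_eq, secondDiff_e, d, d, add_sub_cancel_right]
    rcases le_or_gt 0 j with hj | hj
    · have h := isNabla_e_of_nonneg hj
      rw [secondDiff_e] at h
      convert h using 1
      rw [abs_of_nonneg hj, abs_of_nonneg (by omega)]
      push_cast
      module
    · have h := isNabla_e_of_neg hj
      rw [secondDiff_e] at h
      convert h using 1
      rw [abs_of_neg hj, abs_of_nonpos (by omega)]
      push_cast
      module
  | zero =>
    simpa using IsNabla.smul 0 (isNabla_cauchyFun 1)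
  | add x y _ _ hx hy =>
    have h := hx.add hy
    rw [map_add, map_add]
    convert h using 1
    abel
  | smul c x _ hx =>
    have h := hx.smul c
    rwa [map_smul, map_smul, ← smul_sub]

/-! ### The splitting of `L₊` and `L₋` -/

theorem mulPotential_symm (m : ℕ) (f g : L2) : ⟪mulPotential m f, g⟫ = ⟪f, mulPotential m g⟫ := by
  have h1 := inner_mulB 1 f g
  have h2 := inner_mulB (-1) f g
  rw [neg_neg] at h2
  rw [mulPotential_eq, mulPotential_eq, secondDiff_apply 1, secondDiff_apply 1]
  simp only [inner_smul_left, inner_smul_right, inner_sub_left, inner_sub_right, map_div₀,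
    Complex.conj_ofNat, Complex.conj_natCast, h1, h2]
  ring

theorem opLplus_symm (m : ℕ) : (opLplus m).IsFormalAdjoint (opLplus m) := by
  intro f g
  have h := absNabla_symm f g
  change ⟪-mulPotential m f + absNabla f, (g : L2)⟫ = ⟪(f : L2), -mulPotential m g + absNabla g⟫
  rw [inner_add_left, inner_add_right, h, inner_neg_left, inner_neg_right, mulPotential_symm]

theorem opLminus_symm (m : ℕ) : (opLminus m).IsFormalAdjoint (opLminus m) := by
  intro f g
  have h := opLplus_symm m f g
  change ⟪opR m f + opLplus m f, (g : L2)⟫ = ⟪(f : L2), opR m g + opLplus m g⟫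
  rw [inner_add_left, inner_add_right, h, opR_symm]

theorem IsNabla.exists_opLplus_apply (m : ℕ) {f g : L2} (h : IsNabla f g) :
    ∃ h : f ∈ (opLplus m).domain, opLplus m ⟨f, h⟩ = -mulPotential m f + g := by
  obtain ⟨h1, h2⟩ := h.exists_apply
  refine ⟨h1, ?_⟩
  rw [← h2]
  rfl

theorem IsNabla.exists_opLminus_apply (m : ℕ) {f g : L2} (h : IsNabla f g) :
    ∃ h : f ∈ (opLminus m).domain,
      opLminus m ⟨f, h⟩ = opR m f + (-mulPotential m f + g) := by
  obtain ⟨h1, h2⟩ := h.exists_opLplus_apply m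
  refine ⟨h1, ?_⟩
  rw [← h2]
  rfl

instance finiteDimensional_modelSpace (m : ℕ) : FiniteDimensional ℂ (modelSpace m) :=
  FiniteDimensional.span_of_finite ℂ ((Set.finite_Ico _ _).image _)

theorem splits_opLplus (m : ℕ) :
    Splits (opLplus m) absNabla (modelSpace m) (-opR m) (shift m) where
  symm := opLplus_symm m
  finite := finiteDimensional_modelSpace m
  apply_K k hk := by
    obtain ⟨h1, h2⟩ := (isNabla_of_mem_modelSpace hk).exists_opLplus_apply m
    refine ⟨h1, h2.trans ?_⟩
    rw [LinearMap.neg_apply]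
    abel
  map_K k _ := neg_mem (opR_mem_modelSpace m k)
  apply_W g := by
    obtain ⟨h1, h2⟩ := (isNabla_shift m (isNabla_absNabla g)).exists_opLplus_apply m
    refine ⟨h1, h2.trans ?_⟩
    rw [mulPotential_eq]
    abel
  orth _ hk g := inner_shift_eq_zero hk g
  decomp := exists_eq_add_shift m

theorem splits_opLminus (m : ℕ) :
    Splits (opLminus m) absNabla (modelSpace m) 0 (shift m) where
  symm := opLminus_symm m
  finite := finiteDimensional_modelSpace m
  apply_K k hk := by
    obtain ⟨h1, h2⟩ := (isNabla_of_mem_modelSpace hk).exists_opLminus_apply m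
    refine ⟨h1, h2.trans ?_⟩
    rw [LinearMap.zero_apply]
    abel
  map_K _ _ := zero_mem _
  apply_W g := by
    obtain ⟨h1, h2⟩ := (isNabla_shift m (isNabla_absNabla g)).exists_opLminus_apply m
    refine ⟨h1, h2.trans ?_⟩
    rw [mulPotential_eq, opR_shift]
    abel
  orth _ hk g := inner_shift_eq_zero hk g
  decomp := exists_eq_add_shift m

/-! ### The eigenvalues of the Jacobi matrix `-R` on the model space -/

theorem eq_zero_of_mem_modelSpace {m : ℕ} {f : L2} (hf : f ∈ modelSpace m)
    (h : ∀ j : ℤ, -m ≤ j → j < m → ⟪e j, f⟫ = 0) : f = 0 := by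
  have h1 : ∀ k ∈ modelSpace m, ⟪k, f⟫ = 0 := by
    intro k hk
    induction hk using Submodule.span_induction with
    | mem x hx =>
      obtain ⟨j, ⟨h1, h2⟩, rfl⟩ := hx
      exact h j h1 h2
    | zero => simp
    | add x y _ _ hx hy => rw [inner_add_left, hx, hy, add_zero]
    | smul c x _ hx => rw [inner_smul_left, hx, mul_zero]
  exact inner_self_eq_zero.1 (h1 f hf)

theorem inner_d (j : ℤ) (f : L2) : ⟪d j, f⟫ = ⟪e (j - 1), f⟫ - ⟪e j, f⟫ := inner_sub_left _ _ _

theorem inner_e_opR {m : ℕ} {j : ℤ} (h1 : -m ≤ j) (h2 : j < m) (f : L2) : ⟪e j, opR m f⟫ =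
    ((m - |j + 1| : ℤ) : ℂ) / 2 * ⟪d (j + 1), f⟫ - ((m - |j| : ℤ) : ℂ) / 2 * ⟪d j, f⟫ := by
  rw [← opR_symm, opR_e h1 h2, inner_sub_left, inner_smul_left, inner_smul_left]
  simp only [map_div₀, map_intCast, Complex.conj_ofNat]

/-- An eigenvector of the Jacobi matrix is determined by its first component. -/
theorem eq_zero_of_inner_first_eq_zero {m : ℕ} {z : ℂ} {f : L2} (hf : f ∈ modelSpace m)
    (h : -opR m f = z • f) (h0 : ⟪e (-m), f⟫ = 0) : f = 0 := by
  -- The three-term recurrence needs two vanishing data: a component and a weighted difference. At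
  -- the start the second is free, because the weight m - |j| is 0 at j = -m.
  have key : ∀ n : ℕ, n < 2 * m → ⟪e (-m + n), f⟫ = 0 ∧
      ((m - |(-m + n : ℤ)| : ℤ) : ℂ) / 2 * ⟪d (-m + n), f⟫ = 0 := by
    intro n
    induction n with
    | zero =>
      intro _
      refine ⟨by simpa using h0, ?_⟩
      simp
    | succ n ih =>
      intro hn
      obtain ⟨h1, h2⟩ := ih (by omega)
      have h3 := inner_e_opR (m := m) (j := -m + n) (by omega) (by omega) f
      rw [show opR m f = -(z • f) by rw [← h, neg_neg], inner_neg_right, inner_smul_right, h1, h2,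
        mul_zero, neg_zero, sub_zero] at h3
      -- The off-diagonal entry is nonzero at interior indices, so the recurrence can be solved for
      -- the next component.
      have hw : ((m - |(-m + n + 1 : ℤ)| : ℤ) : ℂ) / 2 ≠ 0 := by
        refine div_ne_zero ?_ two_ne_zero
        have : |(-m + n + 1 : ℤ)| < m := abs_lt.2 ⟨by omega, by omega⟩
        exact_mod_cast (sub_pos.2 this).ne'
      have h4 : ⟪d (-m + n + 1), f⟫ = 0 := (mul_eq_zero.1 h3.symm).resolve_left hw
      have h5 : (-m + (n + 1 : ℕ) : ℤ) = -m + n + 1 := by push_cast; ring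
      rw [h5]
      refine ⟨?_, by rw [h4, mul_zero]⟩
      rw [inner_d, add_sub_cancel_right, h1, zero_sub, neg_eq_zero] at h4
      exact h4
  refine eq_zero_of_mem_modelSpace hf fun j h1 h2 => ?_
  obtain ⟨n, hn⟩ := Int.eq_ofNat_of_zero_le (show 0 ≤ j + m by omega)
  have h3 := (key n (by omega)).1
  rwa [show (-m + n : ℤ) = j by omega] at h3

/-- Taking the first component is an injective linear functional on eigenvectors. The space V is
abstract so that the bound serves both the matrix and L₊. -/
theorem finrank_le_one_of_forall {V : Type*} [AddCommGroup V] [Module ℂ V] {m : ℕ} {z : ℂ}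
    (i : V →ₗ[ℂ] L2) (hi : Function.Injective i)
    (h : ∀ v, i v ∈ modelSpace m ∧ -opR m (i v) = z • i v) : Module.finrank ℂ V ≤ 1 := by
  have h1 : Function.Injective ((innerₛₗ ℂ (e (-m))).comp i) := by
    rw [injective_iff_map_eq_zero]
    intro v hv
    refine hi ?_
    rw [map_zero]
    exact eq_zero_of_inner_first_eq_zero (h v).1 (h v).2 hv
  simpa using LinearMap.finrank_le_finrank_of_injective h1

theorem finrank_modelSpace (m : ℕ) : Module.finrank ℂ (modelSpace m) = 2 * m := by
  have hb : LinearIndependent ℂ fun i : Fin (2 * m) => e (-m + (i : ℕ)) := by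
    refine linearIndependent_of_ne_zero_of_inner_eq_zero (fun i h => ?_) fun i j hij => ?_
    · have := inner_e_self (-m + (i : ℕ))
      rw [h, inner_zero_left] at this
      exact Real.pi_ne_zero (by exact_mod_cast this.symm)
    · simp only [inner_e]
      rw [if_neg]
      intro h
      exact hij (Fin.ext (by omega))
  have hr : Set.range (fun i : Fin (2 * m) => e (-m + (i : ℕ))) = e '' Set.Ico (-m : ℤ) m := by
    ext f
    constructor
    · rintro ⟨i, rfl⟩
      exact ⟨_, ⟨by omega, by have := i.2; omega⟩, rfl⟩
    · rintro ⟨j, ⟨h1, h2⟩, rfl⟩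
      obtain ⟨n, hn⟩ := Int.eq_ofNat_of_zero_le (show 0 ≤ j + m by omega)
      refine ⟨⟨n, by omega⟩, ?_⟩
      simp only
      congr 1
      omega
  have h := finrank_span_eq_card hb
  rwa [hr, Fintype.card_fin] at h

/-- The Jacobi matrix: the restriction of `-R` to the model space. -/
def jacobi (m : ℕ) : Module.End ℂ (modelSpace m) :=
  (-opR m).restrict fun k _ => neg_mem (opR_mem_modelSpace m k)

theorem jacobi_apply (m : ℕ) (f : modelSpace m) : (jacobi m f : L2) = -opR m f := rfl

theorem jacobi_isSymmetric (m : ℕ) : (jacobi m).IsSymmetric := by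
  intro f g
  rw [Submodule.coe_inner, Submodule.coe_inner, jacobi_apply, jacobi_apply, inner_neg_left,
    inner_neg_right, opR_symm]

theorem hasEigenvalue_jacobi_iff {m : ℕ} {z : ℂ} :
    Module.End.HasEigenvalue (jacobi m) z ↔ z ∈ eigenvaluesOn (modelSpace m) (-opR m) := by
  constructor
  · intro h
    obtain ⟨v, hv⟩ := h.exists_hasEigenvector
    exact ⟨v, v.2, fun h => hv.2 (Subtype.ext h), congrArg Subtype.val hv.apply_eq_smul⟩
  · rintro ⟨k, hk, hk0, h⟩
    exact Module.End.hasEigenvalue_of_hasEigenvector (x := ⟨k, hk⟩)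
      ⟨Module.End.mem_eigenspace_iff.2 (Subtype.ext h), fun h => hk0 (congrArg Subtype.val h)⟩

/-- The eigenvalues of the Jacobi matrix in increasing order. -/
def jacobiEigenvalue (m : ℕ) (k : Fin (2 * m)) : ℝ :=
  -- The list `eigenvalues` is decreasing, hence the reversal.
  (jacobi_isSymmetric m).eigenvalues (finrank_modelSpace m) k.rev

theorem range_jacobiEigenvalue (m : ℕ) : Set.range (fun k => (jacobiEigenvalue m k : ℂ)) =
    eigenvaluesOn (modelSpace m) (-opR m) := by
  ext z
  rw [← hasEigenvalue_jacobi_iff]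
  constructor
  · rintro ⟨k, rfl⟩
    exact (jacobi_isSymmetric m).hasEigenvalue_eigenvalues _ _
  · intro h
    obtain ⟨i, hi⟩ := (jacobi_isSymmetric m).exists_eigenvalues_eq (finrank_modelSpace m) h
    refine ⟨i.rev, ?_⟩
    simp only [jacobiEigenvalue, Fin.rev_rev]
    exact hi

/-- An eigenvalue is listed as often as the dimension of its eigenspace, which is at most one, so
the ordered list has no repetition. -/
theorem jacobiEigenvalue_strictMono (m : ℕ) : StrictMono (jacobiEigenvalue m) := by
  have hS := jacobi_isSymmetric m
  refine Monotone.strictMono_of_injective (fun i j h => hS.eigenvalues_antitone _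
    (Fin.rev_le_rev.2 h)) fun i j h => ?_
  have h1 := hS.card_filter_eigenvalues_eq (finrank_modelSpace m) (jacobiEigenvalue m i : ℂ)
  have h2 : Module.finrank ℂ (Module.End.eigenspace (jacobi m) (jacobiEigenvalue m i : ℂ)) ≤ 1 :=
    finrank_le_one_of_forall ((modelSpace m).subtype.comp (Submodule.subtype _))
      (Subtype.val_injective.comp Subtype.val_injective) fun v =>
        ⟨v.1.2, congrArg Subtype.val (Module.End.mem_eigenspace_iff.1 v.2)⟩
  rw [← h1, Finset.card_le_one] at h2
  refine Fin.rev_injective (h2 _ ?_ _ ?_)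
  · simp [jacobiEigenvalue]
  · rw [h]
    simp [jacobiEigenvalue]

/-- The Fejér weights are nonnegative, so R ≥ 0. This also excludes positive eigenvalues of L₊. -/
theorem nonpos_of_mem_eigenvaluesOn {m : ℕ} {t : ℝ}
    (h : (t : ℂ) ∈ eigenvaluesOn (modelSpace m) (-opR m)) : t ≤ 0 := by
  obtain ⟨k, -, hk0, h⟩ := h
  have h1 := re_inner_opR_nonneg m k
  have h2 : ⟪k, opR m k⟫ = ((-t * ‖k‖ ^ 2 : ℝ) : ℂ) := by
    rw [← neg_neg (opR m k), ← LinearMap.neg_apply, h, inner_neg_right, inner_smul_right,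
      inner_self_eq_norm_sq_to_K]
    push_cast
    simp
  rw [h2, Complex.ofReal_re] at h1
  have h3 : 0 < ‖k‖ ^ 2 := by
    have := norm_pos_iff.2 hk0
    positivity
  by_contra h4
  nlinarith [mul_pos (not_le.1 h4) h3]

/-- The sum of all e_j has equal components, so it is orthogonal to each difference d_p with |p| <
m. -/
theorem zero_mem_eigenvaluesOn {m : ℕ} (hm : 1 ≤ m) :
    (0 : ℂ) ∈ eigenvaluesOn (modelSpace m) (-opR m) := by
  have h : ∀ i : ℤ, -m ≤ i → i < m → ⟪e i, ∑ j ∈ Finset.Ico (-m : ℤ) m, e j⟫ = Real.pi := by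
    intro i h1 h2
    rw [inner_sum]
    simp only [inner_e]
    rw [Finset.sum_ite_eq, if_pos (Finset.mem_Ico.2 ⟨h1, h2⟩)]
  refine ⟨∑ j ∈ Finset.Ico (-m : ℤ) m, e j, sum_mem fun j hj => ?_, fun h0 => ?_, ?_⟩
  · rw [Finset.mem_Ico] at hj
    exact e_mem_modelSpace hj.1 hj.2
  · have h1 := h 0 (by omega) (by omega)
    rw [h0, inner_zero_right] at h1
    exact Real.pi_ne_zero (by exact_mod_cast h1.symm)
  · rw [zero_smul, LinearMap.neg_apply, opR_eq_zero, neg_zero]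
    intro p hp
    rw [abs_lt] at hp
    rw [inner_d, h _ (by omega) (by omega), h _ (by omega) (by omega), sub_self]

theorem jacobiEigenvalue_last {m : ℕ} (hm : 1 ≤ m) (l : Fin (2 * m)) (hl : (l : ℕ) = 2 * m - 1) :
    jacobiEigenvalue m l = 0 := by
  have h1 : ∀ k, jacobiEigenvalue m k ≤ 0 := fun k =>
    nonpos_of_mem_eigenvaluesOn ((range_jacobiEigenvalue m).subset ⟨k, rfl⟩)
  have h2 := zero_mem_eigenvaluesOn hm
  rw [← range_jacobiEigenvalue] at h2
  obtain ⟨k, hk⟩ := h2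
  have hk' : jacobiEigenvalue m k = 0 := Complex.ofReal_eq_zero.1 hk
  refine le_antisymm (h1 _) ?_
  rw [← hk']
  exact (jacobiEigenvalue_strictMono m).monotone (Fin.le_def.2 (by omega))

theorem eigenvaluesOn_modelSpace_zero {m : ℕ} (hm : 1 ≤ m) :
    eigenvaluesOn (modelSpace m) (0 : L2 →ₗ[ℂ] L2) = {0} := by
  ext z
  constructor
  · rintro ⟨k, -, hk0, h⟩
    rw [LinearMap.zero_apply, eq_comm, smul_eq_zero] at h
    exact h.resolve_right hk0
  · rintro rfl
    refine ⟨e 0, e_mem_modelSpace (by omega) (by omega), fun h => ?_, by simp⟩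
    have := inner_e_self 0
    rw [h, inner_zero_left] at this
    exact Real.pi_ne_zero (by exact_mod_cast this.symm)

theorem finrank_eigenspace_opLplus {m : ℕ} {z : ℂ}
    (hz : z ∈ eigenvaluesOn (modelSpace m) (-opR m)) :
    Module.finrank ℂ (eigenspace (opLplus m) z) = 1 := by
  have hI : Complex.I ∈ resolventSet absNabla := mem_resolventSet_absNabla_of_im_ne_zero (by simp)
  have hmem := (splits_opLplus m).mem_eigenspace_iff hI absNabla_no_eigenvalue z
  have := (splits_opLplus m).finiteDimensional_eigenspace hI absNabla_no_eigenvalue z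
  refine le_antisymm ?_ ?_
  · exact finrank_le_one_of_forall (Submodule.subtype _) Subtype.val_injective fun v =>
      (hmem v).1 v.2
  · obtain ⟨k, hk, hk0, h⟩ := hz
    have : Nontrivial (eigenspace (opLplus m) z) :=
      ⟨⟨⟨k, (hmem k).2 ⟨hk, h⟩⟩, 0, fun h => hk0 (congrArg Subtype.val h)⟩⟩
    exact Module.finrank_pos

theorem eigenspace_opLminus_zero (m : ℕ) : eigenspace (opLminus m) 0 = modelSpace m := by
  ext f
  rw [(splits_opLminus m).mem_eigenspace_iff
    (mem_resolventSet_absNabla_of_im_ne_zero (by simp)) absNabla_no_eigenvalue]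
  simp

end HalfWave

end

/-! ### The spectra of `L₊` and `L₋` from the splitting -/

theorem theorem3p3 (m : ℕ) (hm : 1 ≤ m) :
    -- both operators are self-adjoint
    (IsSelfAdjoint (HalfWave.opLplus m) ∧ IsSelfAdjoint (HalfWave.opLminus m)) ∧
    -- (i) the eigenvalues of `L₊`
    (∃ E : Fin (2 * m) → ℝ,
      HalfWave.pointSpectrum (HalfWave.opLplus m) = Set.range (fun k => (E k : ℂ)) ∧
      (∀ k, Module.finrank ℂ (HalfWave.eigenspace (HalfWave.opLplus m) (E k : ℂ)) = 1) ∧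
      StrictMono E ∧
      E ⟨2 * m - 1, by omega⟩ = 0) ∧
    -- (ii) the eigenvalues of `L₋`
    (HalfWave.pointSpectrum (HalfWave.opLminus m) = {0} ∧
      Module.finrank ℂ (HalfWave.eigenspace (HalfWave.opLminus m) 0) = 2 * m) ∧
    -- (iii) the essential spectrum is `[0, ∞)` and contains no eigenvalue `E > 0`
    (HalfWave.essentialSpectrum (HalfWave.opLplus m) = (fun t : ℝ => (t : ℂ)) '' Set.Ici 0 ∧
      HalfWave.essentialSpectrum (HalfWave.opLminus m) = (fun t : ℝ => (t : ℂ)) '' Set.Ici 0 ∧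
      ∀ E : ℝ, 0 < E →
        (E : ℂ) ∉ HalfWave.pointSpectrum (HalfWave.opLplus m) ∧
        (E : ℂ) ∉ HalfWave.pointSpectrum (HalfWave.opLminus m)) := by
  have hI : Complex.I ∈ HalfWave.resolventSet HalfWave.absNabla :=
    HalfWave.mem_resolventSet_absNabla_of_im_ne_zero (by simp)
  have hI' : -Complex.I ∈ HalfWave.resolventSet HalfWave.absNabla :=
    HalfWave.mem_resolventSet_absNabla_of_im_ne_zero (by simp)
  have hp := HalfWave.splits_opLplus m
  have hn := HalfWave.splits_opLminus m
  have hpp := hp.pointSpectrum_eq hI HalfWave.absNabla_no_eigenvalue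
  have hpn := hn.pointSpectrum_eq hI HalfWave.absNabla_no_eigenvalue
  have hr := HalfWave.range_jacobiEigenvalue m
  have h0 := HalfWave.eigenvaluesOn_modelSpace_zero hm
  refine ⟨⟨hp.isSelfAdjoint hI hI', hn.isSelfAdjoint hI hI'⟩,
    ⟨HalfWave.jacobiEigenvalue m, hpp.trans hr.symm,
      fun k => HalfWave.finrank_eigenspace_opLplus (hr.subset ⟨k, rfl⟩),
      HalfWave.jacobiEigenvalue_strictMono m, HalfWave.jacobiEigenvalue_last hm _ rfl⟩,
    ⟨hpn.trans h0, by rw [HalfWave.eigenspace_opLminus_zero, HalfWave.finrank_modelSpace]⟩,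
    hp.essentialSpectrum_eq HalfWave.absNabla_no_eigenvalue HalfWave.spectrum_absNabla
      (hr ▸ Set.finite_range _),
    hn.essentialSpectrum_eq HalfWave.absNabla_no_eigenvalue HalfWave.spectrum_absNabla
      (h0 ▸ Set.finite_singleton _), fun E hE => ⟨fun h => ?_, fun h => ?_⟩⟩
  · rw [hpp] at h
    exact absurd (HalfWave.nonpos_of_mem_eigenvaluesOn h) (not_le.2 hE)
  · rw [hpn, h0, Set.mem_singleton_iff, Complex.ofReal_eq_zero] at h
    exact hE.ne' h
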